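/- Consider the following seven Hamiltonians $H(x,y)$, each with a center at the origin, and the intervals $\Sigma$ of levels $h$ for which $\{H=h\}$ contains an oval $\delta(h)$ around the origin: 1) $H=y^2+x^2-x^3$, $\Sigma=(0,\frac4{27})$; 2) $H=y^2+x^2-xy^2$, $\Sigma=(0,1)$; 3) $H=\frac12y^2+\frac12x^2-\frac13x^3+xy^2$, $\Sigma=(0,\frac16)$; 4) $H=y^2+x^2+x^4$, $\Sigma=(0,\infty)$; 5) $H=y^2+x^2-x^4$, $\Sigma=(0,\frac14)$; 6) $H=y^2+x^2+x^2y^2$, $\Sigma=(0,\infty)$; 7) $H=y^2+x^2-x^2y^2$, $\Sigma=(0,1)$. Let $I_1(h)=\oint_{\delta(h)}y\,dx$, and let $I_2(h)=\oint_{\delta(h)}xy\,dx$ in cases 1), 2) and $I_2(h)=\oint_{\delta(h)}x^2y\,dx$ in cases 3)–7). For $n\ge1$ let $\mathcal V_n$ be the real vector space of all functions on $\Sigma$ of the form $$I(h)=\oint_{\delta(h)}\bigl[g(x,y)\,dx-f(x,y)\,dy\bigr],\qquad f,g\in\mathbb R[x,y],\ \deg f,\deg g\le n .$$ Equivalently,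 $\mathcal V_n$ is the set of all functions $\sum_{0\le i+j\le n-1}c_{ij}I_{ij}(h)$ with $c_{ij}\in\mathbb R$, where $I_{ij}(h)=\iint x^iy^j\,dx\,dy$ over the domain bounded by $\delta(h)$. For $n\ge3$, every $I\in\mathcal V_n$ can be written as $I(h)=\alpha(h)I_1(h)+\beta(h)I_2(h)$ on $\Sigma$ with real polynomials $\alpha,\beta$ satisfying: (i) $\deg\alpha\le[\frac{n-1}2]$, $\deg\beta\le[\frac{n-2}2]$ in cases 1) and 2); (ii) $\deg\alpha\le[\frac{n-1}3]$, $\deg\beta\le[\frac{n-3}3]$ in case 3); (iii) $\deg\alpha\le[\frac{n-1}2]$, $\deg\beta\le[\frac{n-3}2]$ in cases 4) and 5); (iv) $\deg\alpha\le[\frac{n-3}2]$, $\deg\beta\le[\frac{n-3}2]$ in cases 6) and 7). In (i)–(iii) the coefficients of $\alpha$ and $\beta$ may take arbitrary values: conversely, for all $\alpha,\beta$ within these bounds the function $\alpha I_1+\beta I_2$ belongs to $\mathcal V_n$. In (iv) there are $\alpha,\beta$, both of degree exactly $[\frac{n-3}2]$, with $\alpha I_1+\beta I_2\in\mathcal V_n$.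 For all $n\ge1$ the dimension of $\mathcal V_n$ is $n$ in cases 1) and 2), $[\frac{2n+1}3]$ in case 3), $2[\frac{n-1}2]+1$ in cases 4) and 5), and $[\frac{n-1}2]+[\frac{n-1}4]+1$ in cases 6) and 7). -/

import Mathlib

open MeasureTheory

namespace Ovals

/-- The seven planar Hamiltonian systems under consideration. -/
inductive System
  | s1 | s2 | s3 | s4 | s5 | s6 | s7

/-- The Hamiltonian `H (x, y)` of each system. In every case the origin is a center, a strict local
minimum of `H` with `H (0, 0) = 0`. -/
noncomputable def System.H : System → ℝ → ℝ → ℝ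
  | .s1, x, y => y ^ 2 + x ^ 2 - x ^ 3
  | .s2, x, y => y ^ 2 + x ^ 2 - x * y ^ 2
  | .s3, x, y => y ^ 2 / 2 + x ^ 2 / 2 - x ^ 3 / 3 + x * y ^ 2
  | .s4, x, y => y ^ 2 + x ^ 2 + x ^ 4
  | .s5, x, y => y ^ 2 + x ^ 2 - x ^ 4
  | .s6, x, y => y ^ 2 + x ^ 2 + x ^ 2 * y ^ 2
  | .s7, x, y => y ^ 2 + x ^ 2 - x ^ 2 * y ^ 2

/-- The maximal open interval `Σ` of levels `h` carrying an oval around the origin. -/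
noncomputable def System.levels : System → Set ℝ
  | .s1 => Set.Ioo 0 (4 / 27)
  | .s2 => Set.Ioo 0 1
  | .s3 => Set.Ioo 0 (1 / 6)
  | .s4 => Set.Ioi 0
  | .s5 => Set.Ioo 0 (1 / 4)
  | .s6 => Set.Ioi 0
  | .s7 => Set.Ioo 0 1

/-- The open domain bounded by the oval `δ(h)`, i.e. the domain meant by `H < h` in a double
integral: the connected component of `{H < h}` which contains the center `(0, 0)`. -/
def System.region (s : System) (h : ℝ) : Set (ℝ × ℝ) :=
  connectedComponentIn {p : ℝ × ℝ | s.H p.1 p.2 < h} (0, 0)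

/-- The polar equation `r = r(θ)` of the oval `δ(h)`: the distance from the center to the boundary
of the enclosed domain in the direction `θ`. -/
noncomputable def System.radius (s : System) (h θ : ℝ) : ℝ :=
  sSup {r : ℝ | 0 ≤ r ∧ (r * Real.cos θ, r * Real.sin θ) ∈ s.region h}

/-- The oval `δ(h)` of the level curve `H = h`, parametrized by the polar angle. For all seven
Hamiltonians and all `h` in `levels` the radial derivative of `H` is positive on the closed domain
bounded by the oval (the center excepted), so this is a smooth `2π`-periodic parametrization which
runs exactly once through the oval, counterclockwise. -/
noncomputable def System.oval (s : System) (h θ : ℝ) : ℝ × ℝ :=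
  (s.radius h θ * Real.cos θ, s.radius h θ * Real.sin θ)

/-- The line integral `∮_{H=h} (P dx + Q dy)` along the oval `δ(h)`. -/
noncomputable def System.ovalIntegral (s : System) (P Q : ℝ → ℝ → ℝ) (h : ℝ) : ℝ :=
  ∫ θ in (0 : ℝ)..(2 * Real.pi),
    (P (s.oval h θ).1 (s.oval h θ).2 * deriv (fun t => (s.oval h t).1) θ +
     Q (s.oval h θ).1 (s.oval h θ).2 * deriv (fun t => (s.oval h t).2) θ)

/-- `I₁(h) = ∮_{H=h} y dx`. -/
noncomputable def System.I₁ (s : System) (h : ℝ) : ℝ :=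
  s.ovalIntegral (fun _ y => y) (fun _ _ => 0) h

/-- `I₂(h) = ∮_{H=h} x y dx` for the first two systems and `I₂(h) = ∮_{H=h} x² y dx` for the
others. -/
noncomputable def System.I₂ : System → ℝ → ℝ
  | .s1, h => System.s1.ovalIntegral (fun x y => x * y) (fun _ _ => 0) h
  | .s2, h => System.s2.ovalIntegral (fun x y => x * y) (fun _ _ => 0) h
  | s, h => s.ovalIntegral (fun x y => x ^ 2 * y) (fun _ _ => 0) h

/-- The double integral `I_{ij}(h) = ∬_{H<h} x^i y^j dx dy`. -/
noncomputable def System.areaIntegral (s : System) (i j : ℕ) (h : ℝ) : ℝ :=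
  ∫ p in s.region h, p.1 ^ i * p.2 ^ j

/-- The value of a real polynomial in two variables at `(x, y)`. -/
noncomputable def polyFun (p : MvPolynomial (Fin 2) ℝ) (x y : ℝ) : ℝ :=
  MvPolynomial.eval ![x, y] p

/-- The space `V_n` of all functions `I(h) = ∮_{H=h} [g(x,y) dx - f(x,y) dy]` on the interval
`levels`, where `f, g` are real polynomials of degree at most `n`. -/
def System.V (s : System) (n : ℕ) : Set (s.levels → ℝ) :=
  {I | ∃ f g : MvPolynomial (Fin 2) ℝ, f.totalDegree ≤ n ∧ g.totalDegree ≤ n ∧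
    ∀ h : s.levels, I h = s.ovalIntegral (polyFun g) (fun x y => -polyFun f x y) h}

/-- The functions `α(h) I₁(h) + β(h) I₂(h)` on the interval `levels`. -/
noncomputable def System.comb (s : System) (α β : Polynomial ℝ) : s.levels → ℝ :=
  fun h => α.eval (h : ℝ) * s.I₁ h + β.eval (h : ℝ) * s.I₂ h

/-- The set of all `α(h) I₁(h) + β(h) I₂(h)` with `α`, `β` arbitrary real polynomials of degrees at
most `a` and `b`. -/
def System.combs (s : System) (a b : ℕ) : Set (s.levels → ℝ) :=
  {I | ∃ α β : Polynomial ℝ, α.natDegree ≤ a ∧ β.natDegree ≤ b ∧ I = s.comb α β}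

/-- The dimension of the linear space `V_n`. -/
noncomputable def System.dimV (s : System) (n : ℕ) : ℕ :=
  Module.finrank ℝ (Submodule.span ℝ (s.V n))

end Ovals

/-! In polar coordinates H = κ(r² − g(θ) r^(e+2)). After scaling r by √(h/κ) the radius of the oval
is the inverse branch `psi` of one fixed function, evaluated at g(θ)√(h/κ)^e. The endpoint of Σ
keeps this argument below the critical value, so the oval bounds a star-shaped domain and its radius
is differentiable in θ and in h. Every area or line integral becomes an integral of a power of the
radius, a moment `mom i j`, and Green's formula identifies V_n with the span `W n` of the moments of
degree below n (`V_eq_W`).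

The forms (H − h) x^i y^j dx and (H − h) x^i y^j dy integrate to zero over the oval. This gives two
linear relations (`momX`, `momY`) for each (i, j), linking h times a moment to moments of higher
degree. Eliminating either the term with h or a chosen moment of higher degree, and using the
symmetries of H, reduces every moment to polynomial multiples of the two generators `mom 0 0` and
`mom d 0` (`W_le_T`). For systems 1 to 5 multiplication by h raises the degree slowly enough for the
converse (`T_le_W`). For systems 6 and 7 only mixed moments off the diagonal reduce to lower degree;
`W n` is spanned by the diagonal moments (2k, 2k) and the axis moments (2k+2, 0), whose leading
terms in the generators are found in `lead_s6_s7`.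

The dimension count needs the generators to be independent over the polynomials
(`relation_trivial`). They solve a Fuchsian 2×2 system with finite singular points 0 and c. A
relation αJ₁ + βJ₂ = 0 with coprime coefficients, once differentiated, reproduces itself up to a
factor l/(h(h − c)) with l a polynomial of degree at most 1. The residues of this factor at 0 and c
are integers, while its residue at infinity is not, because p is not an integer. The residues sum to
zero, a contradiction. -/

namespace Ovals

/-! ### The scaled radial equation and its inverse branch -/

open Set Filter Topology

/-- The function `v ↦ (v² - 1) / v ^ (n + 2)`, whose inverse branch near `v = 1` describes the radius
of the oval of `r² - z r ^ (n + 2) = 1`. -/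
noncomputable def profile (n : ℕ) (v : ℝ) : ℝ := (v ^ 2 - 1) / v ^ (n + 2)

/-- The critical point of `profile n`. -/
noncomputable def vMax (n : ℕ) : ℝ := √((n + 2) / n)

/-- The maximal value of `profile n` on the positive half line. -/
noncomputable def zMax (n : ℕ) : ℝ := profile n (vMax n)

section
variable {n : ℕ}

lemma vMax_pos (hn : 0 < n) : 0 < vMax n := by
  have : (0 : ℝ) < n := by exact_mod_cast hn
  exact Real.sqrt_pos.2 (by positivity)

lemma vMax_sq (hn : 0 < n) : (n : ℝ) * vMax n ^ 2 = n + 2 := by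
  have : (0 : ℝ) < n := by exact_mod_cast hn
  rw [vMax, Real.sq_sqrt (by positivity)]
  field_simp

lemma lt_vMax_iff (hn : 0 < n) {v : ℝ} (hv : 0 < v) : v < vMax n ↔ n * v ^ 2 < n + 2 := by
  have h0 : (0 : ℝ) < n := by exact_mod_cast hn
  rw [← vMax_sq hn, mul_lt_mul_iff_right₀ h0, sq_lt_sq₀ hv.le (vMax_pos hn).le]

lemma hasDerivAt_profile {v : ℝ} (hv : 0 < v) :
    HasDerivAt (profile n) ((n + 2 - n * v ^ 2) / v ^ (n + 3)) v := by
  have h1 : HasDerivAt (fun v : ℝ => v ^ 2 - 1) (2 * v) v := by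
    simpa using (hasDerivAt_pow 2 v).sub_const 1
  have h2 : HasDerivAt (fun v : ℝ => v ^ (n + 2)) ((n + 2) * v ^ (n + 1)) v := by
    have := hasDerivAt_pow (n + 2) v
    push_cast at this
    exact this
  refine (h1.div h2 (by positivity)).congr_deriv ?_
  field_simp
  ring

lemma continuousOn_profile : ContinuousOn (profile n) (Ioi 0) :=
  fun _ hv => (hasDerivAt_profile hv).continuousAt.continuousWithinAt

lemma strictMonoOn_profile (hn : 0 < n) : StrictMonoOn (profile n) (Ioc 0 (vMax n)) := by
  refine strictMonoOn_of_deriv_pos (convex_Ioc _ _)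
    (continuousOn_profile.mono fun v hv => hv.1) fun v hv => ?_
  rw [interior_Ioc] at hv
  rw [(hasDerivAt_profile hv.1).deriv]
  have := (lt_vMax_iff hn hv.1).1 hv.2
  have := hv.1
  apply div_pos <;> [linarith; positivity]

lemma profile_lt_zMax (hn : 0 < n) {v : ℝ} (hv : v ∈ Ioo 0 (vMax n)) : profile n v < zMax n :=
  strictMonoOn_profile hn ⟨hv.1, hv.2.le⟩ ⟨vMax_pos hn, le_rfl⟩ hv.2

/-- `profile n` is singular at 0, so the intermediate value theorem is applied to the polynomial v²
− z v^(n+2) obtained by clearing the denominator. It vanishes at 0 and exceeds 1 at `vMax n`. -/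
lemma exists_profile_eq (hn : 0 < n) {z : ℝ} (hz : z < zMax n) :
    ∃ v ∈ Ioo 0 (vMax n), profile n v = z := by
  have hm := vMax_pos hn
  have hcont : ContinuousOn (fun v : ℝ => v ^ 2 - z * v ^ (n + 2)) (Icc 0 (vMax n)) := by fun_prop
  have h1 : 1 < vMax n ^ 2 - z * vMax n ^ (n + 2) := by
    rw [zMax, profile, lt_div_iff₀ (by positivity)] at hz
    linarith
  obtain ⟨v, hv, hvz⟩ := intermediate_value_Ioo hm.le hcont
    (show (1 : ℝ) ∈ Ioo _ _ from ⟨by simp, h1⟩)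
  refine ⟨v, hv, ?_⟩
  have := hv.1
  rw [profile, div_eq_iff (by positivity)]
  simp only at hvz
  linarith

/-- The inverse of `profile n` on `(0, vMax n)`. -/
noncomputable def psi (n : ℕ) (z : ℝ) : ℝ := Function.invFunOn (profile n) (Ioo 0 (vMax n)) z

lemma psi_mem (hn : 0 < n) {z : ℝ} (hz : z < zMax n) : psi n z ∈ Ioo 0 (vMax n) :=
  Function.invFunOn_mem (exists_profile_eq hn hz)

lemma profile_psi (hn : 0 < n) {z : ℝ} (hz : z < zMax n) : profile n (psi n z) = z :=
  Function.invFunOn_eq (exists_profile_eq hn hz)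

lemma psi_pos (hn : 0 < n) {z : ℝ} (hz : z < zMax n) : 0 < psi n z := (psi_mem hn hz).1

lemma psi_sq_lt (hn : 0 < n) {z : ℝ} (hz : z < zMax n) : n * psi n z ^ 2 < n + 2 :=
  (lt_vMax_iff hn (psi_pos hn hz)).1 (psi_mem hn hz).2

lemma psi_eq (hn : 0 < n) {z : ℝ} (hz : z < zMax n) : psi n z ^ 2 - z * psi n z ^ (n + 2) = 1 := by
  have h0 := psi_pos hn hz
  have h := profile_psi hn hz
  rw [profile, div_eq_iff (by positivity)] at h
  linarith

lemma lt_psi_iff (hn : 0 < n) {z v : ℝ} (hz : z < zMax n) (hv : v ∈ Ioo 0 (vMax n)) :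
    v < psi n z ↔ v ^ 2 - z * v ^ (n + 2) < 1 := by
  have h := psi_mem hn hz
  have h0 := hv.1
  rw [← (strictMonoOn_profile hn).lt_iff_lt ⟨hv.1, hv.2.le⟩ ⟨h.1, h.2.le⟩, profile_psi hn hz,
    profile, div_lt_iff₀ (by positivity)]
  constructor <;> intro h <;> linarith

lemma psi_lt_iff (hn : 0 < n) {z v : ℝ} (hz : z < zMax n) (hv : v ∈ Ioo 0 (vMax n)) :
    psi n z < v ↔ 1 < v ^ 2 - z * v ^ (n + 2) := by
  have h := psi_mem hn hz
  have h0 := hv.1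
  rw [← (strictMonoOn_profile hn).lt_iff_lt ⟨h.1, h.2.le⟩ ⟨hv.1, hv.2.le⟩, profile_psi hn hz,
    profile, lt_div_iff₀ (by positivity)]
  constructor <;> intro h <;> linarith

/-- An increasing function whose image contains a neighbourhood of the value has no jump there. -/
lemma continuousAt_psi (hn : 0 < n) {z : ℝ} (hz : z < zMax n) : ContinuousAt (psi n) z := by
  refine continuousAt_of_monotoneOn_of_image_mem_nhds (s := Iio (zMax n)) ?_ (Iio_mem_nhds hz) ?_
  · intro a ha b hb hab
    have h1 := psi_mem hn ha
    have h2 := psi_mem hn hb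
    rw [← (strictMonoOn_profile hn).le_iff_le ⟨h1.1, h1.2.le⟩ ⟨h2.1, h2.2.le⟩,
      profile_psi hn ha, profile_psi hn hb]
    exact hab
  · refine mem_of_superset (Ioo_mem_nhds (psi_mem hn hz).1 (psi_mem hn hz).2) fun v hv => ?_
    have hv' := profile_lt_zMax hn hv
    have h1 := psi_mem hn hv'
    exact ⟨profile n v, hv', (strictMonoOn_profile hn).injOn ⟨h1.1, h1.2.le⟩ ⟨hv.1, hv.2.le⟩
      (profile_psi hn hv')⟩

lemma hasDerivAt_psi (hn : 0 < n) {z : ℝ} (hz : z < zMax n) :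
    HasDerivAt (psi n) (psi n z ^ (n + 3) / (n + 2 - n * psi n z ^ 2)) z := by
  have h0 := psi_pos hn hz
  have h1 := psi_sq_lt hn hz
  have h := HasDerivAt.of_local_left_inverse (continuousAt_psi hn hz)
    (hasDerivAt_profile h0) (div_ne_zero (by linarith) (by positivity))
    (by filter_upwards [Iio_mem_nhds hz] with w hw using profile_psi hn hw)
  rwa [inv_div] at h

end

end Ovals

/-! ### Polar description of the ovals and of the domains they bound -/

namespace Ovals

open Set Filter Topology Real

/-- The degree of the nonquadratic part of `H` minus two. -/
def System.e : System → ℕ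
  | .s1 => 1 | .s2 => 1 | .s3 => 1 | .s4 => 2 | .s5 => 2 | .s6 => 2 | .s7 => 2

/-- The coefficient of the quadratic part of `H`. -/
noncomputable def System.κ : System → ℝ
  | .s3 => 1 / 2
  | _ => 1

/-- The angular factor of the nonquadratic part of `H`. -/
noncomputable def System.g : System → ℝ → ℝ
  | .s1, θ => cos θ ^ 3
  | .s2, θ => cos θ * sin θ ^ 2
  | .s3, θ => 2 / 3 * (cos θ ^ 3 - 3 * cos θ * sin θ ^ 2)
  | .s4, θ => -cos θ ^ 4
  | .s5, θ => cos θ ^ 4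
  | .s6, θ => -(cos θ ^ 2 * sin θ ^ 2)
  | .s7, θ => cos θ ^ 2 * sin θ ^ 2

/-- The scaled angular factor, the argument of `psi`. -/
noncomputable def System.zArg (s : System) (h θ : ℝ) : ℝ := s.g θ * √(h / s.κ) ^ s.e

/-- The explicit radius of the oval. -/
noncomputable def System.R (s : System) (h θ : ℝ) : ℝ := √(h / s.κ) * psi s.e (s.zArg h θ)

lemma System.e_pos (s : System) : 0 < s.e := by cases s <;> simp [System.e]

lemma System.κ_pos (s : System) : 0 < s.κ := by cases s <;> simp [System.κ]

lemma System.H_polar (s : System) (r θ : ℝ) :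
    s.H (r * cos θ) (r * sin θ) = s.κ * (r ^ 2 - s.g θ * r ^ (s.e + 2)) := by
  have h := sin_sq_add_cos_sq θ
  have h' : sin θ ^ 2 = 1 - cos θ ^ 2 := by linarith
  cases s <;> simp only [System.H, System.κ, System.g, System.e, mul_pow, h'] <;> ring

lemma System.pos_of_mem {s : System} {h : ℝ} (hh : h ∈ s.levels) : 0 < h := by
  cases s <;> first | exact hh.1 | exact hh

lemma System.isOpen_levels (s : System) : IsOpen s.levels := by
  cases s <;> first | exact isOpen_Ioo | exact isOpen_Ioi

lemma lt_zMax_one {z : ℝ} (hz : 27 * z ^ 2 < 4) : z < zMax 1 := by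
  have h3 : (√3 : ℝ) ^ 2 = 3 := Real.sq_sqrt (by norm_num)
  have h0 : (0 : ℝ) < √3 := by positivity
  have : zMax 1 = 2 / (3 * √3) := by
    have hv : vMax 1 = √3 := by simp only [vMax]; norm_num
    rw [zMax, profile, hv]
    have : (√3 : ℝ) ^ (1 + 2) = 3 * √3 := by rw [pow_succ, h3]
    rw [this, h3]; norm_num
  rw [this, lt_div_iff₀ (by positivity)]
  by_contra hc
  push Not at hc
  have : 2 ^ 2 ≤ (z * (3 * √3)) ^ 2 := pow_le_pow_left₀ (by norm_num) hc 2
  rw [mul_pow, mul_pow, h3] at this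
  linarith

lemma lt_zMax_two {z : ℝ} (hz : 4 * z < 1) : z < zMax 2 := by
  have h2 : (√2 : ℝ) ^ 2 = 2 := Real.sq_sqrt (by norm_num)
  have hv : vMax 2 = √2 := by simp only [vMax]; norm_num
  rw [zMax, profile, hv, show (√2 : ℝ) ^ (2 + 2) = (√2 ^ 2) ^ 2 by ring, h2]
  linarith

/-- Where Σ is bounded, its right endpoint is the level at which the largest argument over all θ
reaches `zMax`, equal to 2/(3√3) for e = 1 and 1/4 for e = 2. For `s4` and `s6` the factor g is
nonpositive and every level works. -/
lemma System.zArg_lt {s : System} {h : ℝ} (hh : h ∈ s.levels) (θ : ℝ) :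
    s.zArg h θ < zMax s.e := by
  have h0 : 0 ≤ h := (System.pos_of_mem hh).le
  have hcs := sin_sq_add_cos_sq θ
  have hs0 := sq_nonneg (sin θ)
  have hc0 := sq_nonneg (cos θ)
  have hc1 : cos θ ^ 2 ≤ 1 := by linarith
  have hs : sin θ ^ 2 = 1 - cos θ ^ 2 := by linarith
  have key1 : ∀ {k g b : ℝ}, 0 ≤ k → g ^ 2 ≤ b → 27 * (b * k) < 4 → g * √k ^ 1 < zMax 1 := by
    intro k g b hk hg hb
    refine lt_zMax_one ?_
    rw [pow_one, mul_pow, Real.sq_sqrt hk]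
    nlinarith
  have key2 : ∀ {k g : ℝ}, 0 ≤ k → 4 * (g * k) < 1 → g * √k ^ 2 < zMax 2 := by
    intro k g hk hb
    refine lt_zMax_two ?_
    rwa [Real.sq_sqrt hk]
  cases s <;> simp only [System.zArg, System.e, System.g, System.κ, System.levels, mem_Ioo, mem_Ioi,
    div_one] at hh ⊢
  · refine key1 h0 (b := 1) ?_ (by linarith [hh.2])
    rw [← pow_mul, mul_comm, pow_mul]
    exact pow_le_one₀ hc0 hc1
  · refine key1 h0 (b := 4 / 27) ?_ (by linarith [hh.2])
    -- With u = cos²θ this product equals 4/27 − u(1 − u)², the gap below the maximum at u = 1/3.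
    have h1 : 0 ≤ (4 / 3 - cos θ ^ 2) * (cos θ ^ 2 - 1 / 3) ^ 2 :=
      mul_nonneg (by linarith) (sq_nonneg _)
    rw [hs]
    nlinarith
  · refine key1 (by positivity) (b := 4 / 9) ?_ (by linarith [hh.2])
    -- (Re w³)² = |w|⁶ − (Im w³)² for w = cos θ + i sin θ.
    have h1 : (cos θ ^ 3 - 3 * cos θ * sin θ ^ 2) ^ 2
        = (sin θ ^ 2 + cos θ ^ 2) ^ 3 - (3 * cos θ ^ 2 * sin θ - sin θ ^ 3) ^ 2 := by ring
    rw [mul_pow, h1, hcs]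
    nlinarith [sq_nonneg (3 * cos θ ^ 2 * sin θ - sin θ ^ 3)]
  · refine key2 h0 ?_
    have : 0 ≤ cos θ ^ 4 * h := by positivity
    linarith
  · refine key2 h0 ?_
    have : cos θ ^ 4 ≤ 1 := by
      rw [show cos θ ^ 4 = (cos θ ^ 2) ^ 2 by ring]; exact pow_le_one₀ hc0 hc1
    nlinarith [hh.2]
  · refine key2 h0 ?_
    have : 0 ≤ cos θ ^ 2 * sin θ ^ 2 * h := by positivity
    linarith
  · refine key2 h0 ?_
    have : cos θ ^ 2 * sin θ ^ 2 ≤ 1 / 4 := by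
      rw [hs]; nlinarith [sq_nonneg (cos θ ^ 2 - 1 / 2)]
    nlinarith [hh.2]

section
variable {s : System} {h : ℝ} (hh : h ∈ s.levels)
include hh

lemma System.level_pos : 0 < h / s.κ := div_pos (System.pos_of_mem hh) s.κ_pos

lemma System.R_pos (θ : ℝ) : 0 < s.R h θ :=
  mul_pos (Real.sqrt_pos.2 (System.level_pos hh)) (psi_pos s.e_pos (s.zArg_lt hh θ))

lemma System.H_scaled (v θ : ℝ) :
    s.H (√(h / s.κ) * v * cos θ) (√(h / s.κ) * v * sin θ) =
      h * (v ^ 2 - s.zArg h θ * v ^ (s.e + 2)) := by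
  have hk := s.κ_pos.ne'
  have hq : √(h / s.κ) ^ 2 = h / s.κ := Real.sq_sqrt (System.level_pos hh).le
  rw [System.H_polar, System.zArg]
  calc _ = s.κ * √(h / s.κ) ^ 2 * (v ^ 2 - s.g θ * √(h / s.κ) ^ s.e * v ^ (s.e + 2)) := by ring
    _ = _ := by rw [hq]; field_simp

lemma System.H_R (θ : ℝ) : s.H (s.R h θ * cos θ) (s.R h θ * sin θ) = h := by
  rw [System.R, System.H_scaled hh, psi_eq s.e_pos (s.zArg_lt hh θ), mul_one]

lemma System.exists_scaled (r : ℝ) : ∃ v, r = √(h / s.κ) * v :=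
  ⟨r / √(h / s.κ), by have := Real.sqrt_pos.2 (System.level_pos hh); field_simp⟩

lemma System.H_lt {r θ : ℝ} (h0 : 0 ≤ r) (hr : r < s.R h θ) : s.H (r * cos θ) (r * sin θ) < h := by
  have hq := Real.sqrt_pos.2 (System.level_pos hh)
  have hp := System.pos_of_mem hh
  obtain ⟨v, rfl⟩ := System.exists_scaled hh r
  rw [System.R, mul_lt_mul_iff_right₀ hq] at hr
  rw [System.H_scaled hh]
  have hz := s.zArg_lt hh θ
  rcases (nonneg_of_mul_nonneg_right h0 hq).eq_or_lt with rfl | hv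
  · simpa using hp
  · have := (lt_psi_iff s.e_pos hz ⟨hv, hr.trans (psi_mem s.e_pos hz).2⟩).1 hr
    nlinarith

/-- Beyond the critical point of the radial equation H may fall below h again, so the claim concerns
some point between the oval and r: one whose scaled radius is still below `vMax`. -/
lemma System.exists_lt_H {r θ : ℝ} (hr : s.R h θ < r) :
    ∃ r' ∈ Ioo (s.R h θ) r, h < s.H (r' * cos θ) (r' * sin θ) := by
  have hq := Real.sqrt_pos.2 (System.level_pos hh)
  have hp := System.pos_of_mem hh
  have hz := s.zArg_lt hh θ
  have hmem := psi_mem s.e_pos hz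
  obtain ⟨v, rfl⟩ := System.exists_scaled hh r
  rw [System.R, mul_lt_mul_iff_right₀ hq] at hr
  obtain ⟨w, hw1, hw2⟩ := exists_between (lt_min hr hmem.2)
  have hw := lt_min_iff.1 hw2
  refine ⟨√(h / s.κ) * w, ⟨?_, ?_⟩, ?_⟩
  · rwa [System.R, mul_lt_mul_iff_right₀ hq]
  · rw [mul_lt_mul_iff_right₀ hq]; exact hw.1
  · rw [System.H_scaled hh]
    have := (psi_lt_iff s.e_pos hz ⟨hmem.1.trans hw1, hw.2⟩).1 hw1
    nlinarith

end

lemma System.continuous_H (s : System) : Continuous fun p : ℝ × ℝ => s.H p.1 p.2 := by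
  cases s <;> simp only [System.H] <;> fun_prop

/-- The points which can be joined to the origin by a segment inside `H < h`. -/
def System.inner (s : System) (h : ℝ) : Set (ℝ × ℝ) :=
  {p | ∀ t ∈ Icc (0 : ℝ) 1, s.H (t * p.1) (t * p.2) < h}

lemma exists_polar (p : ℝ × ℝ) : ∃ r θ : ℝ, 0 ≤ r ∧ p = (r * cos θ, r * sin θ) := by
  refine ⟨‖(⟨p.1, p.2⟩ : ℂ)‖, Complex.arg ⟨p.1, p.2⟩, norm_nonneg _, ?_⟩
  rw [Complex.norm_mul_cos_arg, Complex.norm_mul_sin_arg]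

lemma System.isOpen_inner (s : System) (h : ℝ) : IsOpen (s.inner h) := by
  rw [isOpen_iff_mem_nhds]
  intro p hp
  refine isCompact_Icc.eventually_forall_of_forall_eventually fun t ht => ?_
  have hc : Continuous fun q : (ℝ × ℝ) × ℝ => s.H (q.2 * q.1.1) (q.2 * q.1.2) :=
    s.continuous_H.comp (f := fun q : (ℝ × ℝ) × ℝ => (q.2 * q.1.1, q.2 * q.1.2)) (by fun_prop)
  exact (isOpen_lt hc continuous_const).mem_nhds (hp t ht)

section
variable {s : System} {h : ℝ} (hh : h ∈ s.levels)
include hh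

lemma System.mem_inner_iff {r θ : ℝ} (hr : 0 ≤ r) :
    (r * cos θ, r * sin θ) ∈ s.inner h ↔ r < s.R h θ := by
  have hR := System.R_pos hh θ
  constructor
  · intro hmem
    by_contra hc
    push Not at hc
    have h1 := hmem (s.R h θ / r) ⟨div_nonneg hR.le hr, div_le_one_of_le₀ hc hr⟩
    have hr0 : r ≠ 0 := (hR.trans_le hc).ne'
    simp only [← mul_assoc, div_mul_cancel₀ _ hr0, System.H_R hh, lt_irrefl] at h1
  · intro hlt t ht
    simp only [← mul_assoc]
    exact System.H_lt hh (mul_nonneg ht.1 hr) ((mul_le_of_le_one_left hr ht.2).trans_lt hlt)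

/-- The star-shaped set `inner` is connected and contains the center. It is also open, and the rest
of {H < h} lies in the disjoint open set of points whose segment to the center rises above h, so the
component cannot leave `inner`. -/
lemma System.region_eq : s.region h = s.inner h := by
  have h0 : (0, 0) ∈ s.inner h := by
    have := (System.mem_inner_iff hh (r := 0) (θ := 0) le_rfl).2 (System.R_pos hh 0)
    simpa using this
  have hsub : s.inner h ⊆ {p : ℝ × ℝ | s.H p.1 p.2 < h} := fun p hp => by
    simpa using hp 1 ⟨zero_le_one, le_rfl⟩
  apply Subset.antisymm
  · set O : Set (ℝ × ℝ) := ⋃ t ∈ Icc (0 : ℝ) 1, {p | h < s.H (t * p.1) (t * p.2)} with hO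
    have hOo : IsOpen O := isOpen_biUnion fun t _ => isOpen_lt continuous_const
      (s.continuous_H.comp (f := fun p : ℝ × ℝ => (t * p.1, t * p.2)) (by fun_prop))
    refine isPreconnected_connectedComponentIn.subset_left_of_subset_union (s.isOpen_inner h) hOo
      ?_ ?_ ⟨(0, 0), mem_connectedComponentIn (hsub h0), h0⟩
    · rw [Set.disjoint_left]
      intro p hp hpO
      simp only [hO, mem_iUnion] at hpO
      obtain ⟨t, ht, hlt⟩ := hpO
      exact lt_asymm (hp t ht) hlt
    · intro p hp
      have hpH := connectedComponentIn_subset _ _ hp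
      obtain ⟨r, θ, hr, rfl⟩ := exists_polar p
      rcases lt_trichotomy r (s.R h θ) with hlt | heq | hgt
      · exact Or.inl ((System.mem_inner_iff hh hr).2 hlt)
      · rw [mem_ofPred_eq, heq, System.H_R hh] at hpH
        exact absurd hpH (lt_irrefl _)
      · obtain ⟨r', ⟨h1, h2⟩, h3⟩ := System.exists_lt_H hh hgt
        have hR := System.R_pos hh θ
        have hr0 : r ≠ 0 := (hR.trans hgt).ne'
        refine Or.inr ?_
        simp only [hO, mem_iUnion]
        refine ⟨r' / r, ⟨div_nonneg (hR.trans h1).le hr, div_le_one_of_le₀ h2.le hr⟩, ?_⟩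
        simpa only [mem_ofPred_eq, ← mul_assoc, div_mul_cancel₀ _ hr0] using h3
  · refine IsPreconnected.subset_connectedComponentIn ?_ h0 hsub
    have hstar : StarConvex ℝ ((0 : ℝ), (0 : ℝ)) (s.inner h) := by
      rw [show ((0 : ℝ), (0 : ℝ)) = 0 from rfl, starConvex_zero_iff]
      intro p hp a ha ha1 t ht
      have := hp (t * a) ⟨mul_nonneg ht.1 ha, mul_le_one₀ ht.2 ha ha1⟩
      simpa [mul_assoc] using this
    exact (hstar.isPathConnected h0).isConnected.isPreconnected

lemma System.mem_region_iff {r θ : ℝ} (hr : 0 ≤ r) :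
    (r * cos θ, r * sin θ) ∈ s.region h ↔ r < s.R h θ := by
  rw [System.region_eq hh, System.mem_inner_iff hh hr]

lemma System.radius_eq (θ : ℝ) : s.radius h θ = s.R h θ := by
  have : {r : ℝ | 0 ≤ r ∧ (r * cos θ, r * sin θ) ∈ s.region h} = Ico 0 (s.R h θ) := by
    ext r
    exact and_congr_right fun hr => System.mem_region_iff hh hr
  rw [System.radius, this, csSup_Ico (System.R_pos hh θ)]

end

end Ovals

/-! ### Derivatives of the radius, and area integrals as angular moments -/

namespace Ovals

open Set Filter Topology Real

/-- The derivative of `psi n`. -/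
noncomputable def dPsi (n : ℕ) (z : ℝ) : ℝ := psi n z ^ (n + 3) / (n + 2 - n * psi n z ^ 2)

lemma continuousAt_dPsi {n : ℕ} (hn : 0 < n) {z : ℝ} (hz : z < zMax n) :
    ContinuousAt (dPsi n) z := by
  have h := continuousAt_psi hn hz
  have h1 := psi_sq_lt hn hz
  exact (h.pow _).div (continuousAt_const.sub (continuousAt_const.mul (h.pow 2))) (by linarith)

lemma System.contDiff_g (s : System) : ContDiff ℝ 1 s.g := by
  cases s <;> (unfold System.g; fun_prop)

lemma System.periodic_g (s : System) : Function.Periodic s.g (2 * π) := by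
  intro θ
  cases s <;> simp only [System.g, cos_add_two_pi, sin_add_two_pi]

lemma System.periodic_R (s : System) (h : ℝ) : Function.Periodic (s.R h) (2 * π) := by
  intro θ
  simp only [System.R, System.zArg, s.periodic_g θ]

/-- The derivative of the radius in the direction of the angle. -/
noncomputable def System.dRθ (s : System) (h θ : ℝ) : ℝ :=
  √(h / s.κ) * (dPsi s.e (s.zArg h θ) * (deriv s.g θ * √(h / s.κ) ^ s.e))

/-- The derivative of the radius in the direction of the level. -/
noncomputable def System.dRh (s : System) (h θ : ℝ) : ℝ :=
  s.R h θ / (2 * h) + √(h / s.κ) * (dPsi s.e (s.zArg h θ) * (s.e * s.zArg h θ / (2 * h)))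

lemma System.continuous_zArg (s : System) : Continuous fun p : ℝ × ℝ => s.zArg p.1 p.2 := by
  have := s.contDiff_g.continuous
  unfold System.zArg
  fun_prop

lemma System.continuousOn_R (s : System) :
    ContinuousOn (fun p : ℝ × ℝ => s.R p.1 p.2) (s.levels ×ˢ univ) := by
  intro p hp
  refine ContinuousAt.continuousWithinAt ?_
  have h1 : ContinuousAt (fun p : ℝ × ℝ => psi s.e (s.zArg p.1 p.2)) p :=
    ContinuousAt.comp (f := fun p : ℝ × ℝ => s.zArg p.1 p.2) (g := psi s.e)
      (continuousAt_psi s.e_pos (s.zArg_lt hp.1 p.2)) s.continuous_zArg.continuousAt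
  have h2 : ContinuousAt (fun p : ℝ × ℝ => √(p.1 / s.κ)) p := by fun_prop
  exact h2.mul h1

lemma System.continuousOn_dRh (s : System) :
    ContinuousOn (fun p : ℝ × ℝ => s.dRh p.1 p.2) (s.levels ×ˢ univ) := by
  have h0 : ∀ p ∈ s.levels ×ˢ (univ : Set ℝ), 2 * p.1 ≠ 0 := fun p hp => by
    have := System.pos_of_mem hp.1; positivity
  have h1 : ContinuousOn (fun p : ℝ × ℝ => dPsi s.e (s.zArg p.1 p.2)) (s.levels ×ˢ univ) :=
    fun p hp => (ContinuousAt.comp (f := fun p : ℝ × ℝ => s.zArg p.1 p.2) (g := dPsi s.e)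
      (continuousAt_dPsi s.e_pos (s.zArg_lt hp.1 p.2))
      s.continuous_zArg.continuousAt).continuousWithinAt
  have h2 : ContinuousOn (fun p : ℝ × ℝ => √(p.1 / s.κ)) (s.levels ×ˢ univ) := by fun_prop
  have h3 : ContinuousOn (fun p : ℝ × ℝ => s.e * s.zArg p.1 p.2) (s.levels ×ˢ (univ : Set ℝ)) :=
    (continuous_const.mul s.continuous_zArg).continuousOn
  have h4 : ContinuousOn (fun p : ℝ × ℝ => 2 * p.1) (s.levels ×ˢ (univ : Set ℝ)) := by fun_prop
  exact (s.continuousOn_R.div h4 h0).add (h2.mul (h1.mul (h3.div h4 h0)))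

section
variable {s : System} {h : ℝ} (hh : h ∈ s.levels)
include hh

lemma System.continuous_R : Continuous (s.R h) :=
  continuousOn_univ.1 (s.continuousOn_R.comp (f := fun θ : ℝ => (h, θ)) (by fun_prop)
    fun θ _ => ⟨hh, mem_univ θ⟩)

lemma System.continuous_dRh : Continuous (s.dRh h) :=
  continuousOn_univ.1 (s.continuousOn_dRh.comp (f := fun θ : ℝ => (h, θ)) (by fun_prop)
    fun θ _ => ⟨hh, mem_univ θ⟩)

lemma System.continuous_dRθ : Continuous (s.dRθ h) := by
  have h1 : Continuous fun θ => dPsi s.e (s.zArg h θ) := continuous_iff_continuousAt.2 fun θ =>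
    ContinuousAt.comp (f := fun θ => s.zArg h θ) (g := dPsi s.e)
      (continuousAt_dPsi s.e_pos (s.zArg_lt hh θ))
      (s.continuous_zArg.comp (f := fun θ : ℝ => (h, θ)) (by fun_prop)).continuousAt
  have h2 : Continuous (deriv s.g) := s.contDiff_g.continuous_deriv le_rfl
  unfold System.dRθ
  fun_prop

lemma System.hasDerivAt_R_angle (θ : ℝ) : HasDerivAt (s.R h) (s.dRθ h θ) θ := by
  have h1 : HasDerivAt (s.zArg h) (deriv s.g θ * √(h / s.κ) ^ s.e) θ :=
    ((s.contDiff_g.differentiable one_ne_zero) θ).hasDerivAt.mul_const _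
  exact ((hasDerivAt_psi s.e_pos (s.zArg_lt hh θ)).comp θ h1).const_mul _

lemma System.hasDerivAt_R_level (θ : ℝ) : HasDerivAt (fun h => s.R h θ) (s.dRh h θ) h := by
  have hp := System.pos_of_mem hh
  have hk := s.κ_pos
  have hq := Real.sqrt_pos.2 (System.level_pos hh)
  have hq2 : √(h / s.κ) ^ 2 = h / s.κ := Real.sq_sqrt (System.level_pos hh).le
  have h1 : HasDerivAt (fun h => √(h / s.κ)) (√(h / s.κ) / (2 * h)) h := by
    refine (((hasDerivAt_id h).div_const s.κ).sqrt (System.level_pos hh).ne').congr_deriv ?_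
    simp only [id]
    field_simp
    rw [hq2]; field_simp
  have h2 : HasDerivAt (fun h => s.zArg h θ) (s.e * s.zArg h θ / (2 * h)) h := by
    refine ((h1.pow s.e).const_mul (s.g θ)).congr_deriv ?_
    obtain ⟨n, hn⟩ : ∃ n, s.e = n + 1 := ⟨s.e - 1, by have := s.e_pos; omega⟩
    rw [System.zArg, hn]
    simp only [Nat.add_sub_cancel]
    ring
  refine (h1.mul ((hasDerivAt_psi s.e_pos (s.zArg_lt hh θ)).comp h h2)).congr_deriv ?_
  change √(h / s.κ) / (2 * h) * psi s.e (s.zArg h θ) + √(h / s.κ) * (dPsi s.e (s.zArg h θ) *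
    (s.e * s.zArg h θ / (2 * h))) = √(h / s.κ) * psi s.e (s.zArg h θ) / (2 * h) + _
  rw [mul_div_right_comm (√(h / s.κ))]

end

/-- The moment `∬ x ^ i y ^ j` in polar coordinates. -/
noncomputable def System.mom (s : System) (i j : ℕ) (h : ℝ) : ℝ :=
  ∫ θ in (0 : ℝ)..(2 * π), s.R h θ ^ (i + j + 2) / (i + j + 2 : ℕ) * (cos θ ^ i * sin θ ^ j)

lemma System.areaIntegral_eq {s : System} {h : ℝ} (hh : h ∈ s.levels) (i j : ℕ) :
    s.areaIntegral i j h = s.mom i j h := by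
  have hRc := System.continuous_R hh
  set f : ℝ × ℝ → ℝ := fun p => p.1 ^ (i + j + 1) * (cos p.2 ^ i * sin p.2 ^ j) with hf
  have hfc : Continuous f := by fun_prop
  set D : Set (ℝ × ℝ) := {p | p.1 < s.R h p.2} with hD
  have hDm : MeasurableSet D :=
    (isOpen_lt continuous_fst (hRc.comp continuous_snd)).measurableSet
  have hregion : MeasurableSet (s.region h) := by
    rw [System.region_eq hh]; exact (s.isOpen_inner h).measurableSet
  have htm : MeasurableSet polarCoord.target := polarCoord.open_target.measurableSet
  have h1 : s.areaIntegral i j h = ∫ p in polarCoord.target, D.indicator f p := by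
    rw [System.areaIntegral, ← integral_indicator hregion, ← integral_comp_polarCoord_symm]
    refine setIntegral_congr_fun htm fun p hp => ?_
    have hp0 : 0 < p.1 := hp.1
    simp only [polarCoord_symm_apply, smul_eq_mul, indicator, System.mem_region_iff hh hp0.le,
      hD, mem_ofPred_eq, hf]
    split_ifs <;> ring
  have hint : Integrable ((polarCoord.target ∩ D).indicator f) (volume.prod volume) := by
    rw [integrable_indicator_iff (htm.inter hDm)]
    obtain ⟨M, hM⟩ := (isCompact_Icc (a := -π) (b := π)).exists_bound_of_continuousOn
      hRc.continuousOn
    refine IntegrableOn.mono_set (t := Icc 0 M ×ˢ Icc (-π) π)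
      (hfc.continuousOn.integrableOn_compact (isCompact_Icc.prod isCompact_Icc)) ?_
    rintro p ⟨⟨hp1, hp2⟩, hp3⟩
    have hp2' : p.2 ∈ Icc (-π) π := ⟨hp2.1.le, hp2.2.le⟩
    exact ⟨⟨le_of_lt hp1, (le_of_lt hp3).trans ((le_abs_self _).trans (hM _ hp2'))⟩, hp2'⟩
  have h2 : s.areaIntegral i j h = ∫ θ in Ioo (-π) π,
      s.R h θ ^ (i + j + 2) / (i + j + 2 : ℕ) * (cos θ ^ i * sin θ ^ j) := by
    rw [h1, ← integral_indicator htm, indicator_indicator, Measure.volume_eq_prod,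
      integral_prod_symm _ hint, ← integral_indicator measurableSet_Ioo]
    congr 1 with θ
    by_cases hθ : θ ∈ Ioo (-π) π
    · have hR := System.R_pos hh θ
      rw [indicator_of_mem hθ]
      have : ∀ r, (polarCoord.target ∩ D).indicator f (r, θ) =
          (Ioo 0 (s.R h θ)).indicator (fun r => f (r, θ)) r := by
        intro r
        have : (r, θ) ∈ polarCoord.target ∩ D ↔ r ∈ Ioo 0 (s.R h θ) :=
          ⟨fun h => ⟨h.1.1, h.2⟩, fun h => ⟨⟨h.1, hθ⟩, h.2⟩⟩
        simp only [indicator, this]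
      simp only [this]
      rw [integral_indicator measurableSet_Ioo, ← integral_Ioc_eq_integral_Ioo,
        ← intervalIntegral.integral_of_le hR.le, hf]
      simp only [intervalIntegral.integral_mul_const, integral_pow]
      push_cast
      ring
    · rw [indicator_of_notMem hθ]
      refine integral_eq_zero_of_ae (Eventually.of_forall fun r => ?_)
      exact indicator_of_notMem (fun hr => hθ hr.1.2) _
  -- Polar coordinates use the angles (−π, π) whereas `mom` uses [0, 2π]; periodicity identifies the
  -- two integrals.
  have hper : Function.Periodic (fun θ =>
      s.R h θ ^ (i + j + 2) / (i + j + 2 : ℕ) * (cos θ ^ i * sin θ ^ j)) (2 * π) := fun θ => by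
    simp only [s.periodic_R h θ, cos_add_two_pi, sin_add_two_pi]
  have h3 := hper.intervalIntegral_add_eq (-π) 0
  rw [zero_add, show -π + 2 * π = π by ring] at h3
  rw [h2, System.mom, ← h3, intervalIntegral.integral_of_le (by linarith [pi_pos]),
    integral_Ioc_eq_integral_Ioo]

end Ovals

/-! ### Green's formula and linear relations between moments and their derivatives -/

namespace Ovals

open Set Filter Topology Real

/-- Differentiation under the integral sign for a continuous derivative. -/
lemma hasDerivAt_integral_of_continuousOn {F F' : ℝ → ℝ → ℝ} {S : Set ℝ} (hS : IsOpen S) {a b x : ℝ}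
    (hx : x ∈ S) (hF : ∀ y ∈ S, Continuous (F y))
    (hF' : ContinuousOn (fun p : ℝ × ℝ => F' p.1 p.2) (S ×ˢ univ))
    (hd : ∀ y ∈ S, ∀ t, HasDerivAt (fun y => F y t) (F' y t) y) :
    HasDerivAt (fun y => ∫ t in a..b, F y t) (∫ t in a..b, F' x t) x := by
  obtain ⟨ε, hε, hball⟩ := Metric.nhds_basis_closedBall.mem_iff.1 (hS.mem_nhds hx)
  obtain ⟨C, hC⟩ := ((isCompact_closedBall x ε).prod (isCompact_uIcc (a := a) (b := b))
    ).exists_bound_of_continuousOn (hF'.mono (prod_mono hball (subset_univ _)))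
  have hc : Continuous (F' x) := continuousOn_univ.1
    (hF'.comp (f := fun t : ℝ => (x, t)) (by fun_prop) fun t _ => ⟨hx, mem_univ t⟩)
  refine (intervalIntegral.hasDerivAt_integral_of_dominated_loc_of_deriv_le
    (bound := fun _ => C) (Metric.closedBall_mem_nhds x hε) ?_ ((hF x hx).intervalIntegrable _ _)
    hc.aestronglyMeasurable ?_ intervalIntegrable_const ?_).2
  · filter_upwards [hS.mem_nhds hx] with y hy using (hF y hy).aestronglyMeasurable
  · exact Eventually.of_forall fun t ht y hy => hC (y, t) ⟨hy, uIoc_subset_uIcc ht⟩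
  · exact Eventually.of_forall fun t _ y hy => hd y (hball hy) t

/-- The derivative of the moment `s.mom i j` in the level. -/
noncomputable def System.dmom (s : System) (i j : ℕ) (h : ℝ) : ℝ :=
  ∫ θ in (0 : ℝ)..(2 * π), s.R h θ ^ (i + j + 1) * s.dRh h θ * (cos θ ^ i * sin θ ^ j)

/-- The coefficients of the monomials of `H`. -/
noncomputable def System.coef : System → Fin 4 → ℝ
  | .s1 => ![1, 1, -1, 0]
  | .s2 => ![1, 1, -1, 0]
  | .s3 => ![1 / 2, 1 / 2, -1 / 3, 1]
  | .s4 => ![1, 1, 1, 0]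
  | .s5 => ![1, 1, -1, 0]
  | .s6 => ![1, 1, 1, 0]
  | .s7 => ![1, 1, -1, 0]

/-- The exponents of `x` in the monomials of `H`. -/
def System.expX : System → Fin 4 → ℕ
  | .s1 => ![0, 2, 3, 0]
  | .s2 => ![0, 2, 1, 0]
  | .s3 => ![0, 2, 3, 1]
  | .s4 => ![0, 2, 4, 0]
  | .s5 => ![0, 2, 4, 0]
  | .s6 => ![0, 2, 2, 0]
  | .s7 => ![0, 2, 2, 0]

/-- The exponents of `y` in the monomials of `H`. -/
def System.expY : System → Fin 4 → ℕ
  | .s1 => ![2, 0, 0, 0]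
  | .s2 => ![2, 0, 2, 0]
  | .s3 => ![2, 0, 0, 2]
  | .s4 => ![2, 0, 0, 0]
  | .s5 => ![2, 0, 0, 0]
  | .s6 => ![2, 0, 2, 0]
  | .s7 => ![2, 0, 2, 0]

/-- Only `s3` has four monomials; the others are padded with a zero coefficient so that one indexed
sum serves all systems. -/
lemma System.H_eq_sum (s : System) (x y : ℝ) :
    s.H x y = ∑ k, s.coef k * (x ^ s.expX k * y ^ s.expY k) := by
  cases s <;> simp [System.H, System.coef, System.expX, System.expY, Fin.sum_univ_four] <;> ring

/-- The counterclockwise integral `∮ x ^ i y ^ j dx`. -/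
noncomputable def System.lineX (s : System) (i j : ℕ) (h : ℝ) : ℝ :=
  ∫ θ in (0 : ℝ)..(2 * π), (s.R h θ * cos θ) ^ i * (s.R h θ * sin θ) ^ j *
    (s.dRθ h θ * cos θ - s.R h θ * sin θ)

/-- The counterclockwise integral `∮ x ^ i y ^ j dy`. -/
noncomputable def System.lineY (s : System) (i j : ℕ) (h : ℝ) : ℝ :=
  ∫ θ in (0 : ℝ)..(2 * π), (s.R h θ * cos θ) ^ i * (s.R h θ * sin θ) ^ j *
    (s.dRθ h θ * sin θ + s.R h θ * cos θ)

lemma hasDerivAt_cos_pow_mul_sin_pow (i j : ℕ) (θ : ℝ) :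
    HasDerivAt (fun θ => cos θ ^ i * sin θ ^ j)
      (-(i * cos θ ^ (i - 1) * sin θ ^ (j + 1)) + j * cos θ ^ (i + 1) * sin θ ^ (j - 1)) θ := by
  refine (((hasDerivAt_cos θ).pow i).mul ((hasDerivAt_sin θ).pow j)).congr_deriv ?_
  simp only [Pi.pow_apply]
  ring

section
variable {s : System} {h : ℝ} (hh : h ∈ s.levels)
include hh

lemma System.hasDerivAt_mom (i j : ℕ) : HasDerivAt (s.mom i j) (s.dmom i j h) h := by
  refine hasDerivAt_integral_of_continuousOn (F' := fun h θ =>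
    s.R h θ ^ (i + j + 1) * s.dRh h θ * (cos θ ^ i * sin θ ^ j)) s.isOpen_levels hh ?_ ?_ ?_
  · intro y hy
    have := System.continuous_R hy
    fun_prop
  · have h1 := s.continuousOn_R
    have h2 := s.continuousOn_dRh
    fun_prop
  · intro y hy θ
    refine ((((System.hasDerivAt_R_level hy θ).pow (i + j + 2)).div_const _).mul_const
      _).congr_deriv ?_
    have : ((i + j + 2 : ℕ) : ℝ) ≠ 0 := by positivity
    rw [show i + j + 2 - 1 = i + j + 1 by omega]
    field_simp

/-- `dmom` is an integral over the oval itself, where H = h, so the factor h may be replaced by the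
monomials of H under the integral. -/
lemma System.coarea (i j : ℕ) :
    h * s.dmom i j h = ∑ k, s.coef k * s.dmom (s.expX k + i) (s.expY k + j) h := by
  have h1 := System.continuous_R hh
  have h2 := System.continuous_dRh hh
  simp only [System.dmom, ← intervalIntegral.integral_const_mul]
  rw [← intervalIntegral.integral_finsetSum
    fun k _ => Continuous.intervalIntegrable (by fun_prop) _ _]
  refine intervalIntegral.integral_congr fun θ _ => ?_
  have hH := System.H_R hh θ
  rw [System.H_eq_sum] at hH
  refine (congrArg (fun z => z * _) hH).symm.trans ?_
  rw [Finset.sum_mul]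
  refine Finset.sum_congr rfl fun k _ => ?_
  ring

lemma System.integral_deriv_eq_zero (N i j : ℕ) :
    ∫ θ in (0 : ℝ)..(2 * π), ((N + 1) * s.R h θ ^ N * s.dRθ h θ * (cos θ ^ i * sin θ ^ j) +
      s.R h θ ^ (N + 1) * (-(i * cos θ ^ (i - 1) * sin θ ^ (j + 1)) +
        j * cos θ ^ (i + 1) * sin θ ^ (j - 1))) = 0 := by
  have h1 := System.continuous_R hh
  have h2 := System.continuous_dRθ hh
  rw [intervalIntegral.integral_eq_sub_of_hasDerivAt
    (f := fun θ => s.R h θ ^ (N + 1) * (cos θ ^ i * sin θ ^ j))]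
  · have := s.periodic_R h 0
    rw [zero_add] at this
    simp [this]
  · intro θ _
    refine (((System.hasDerivAt_R_angle hh θ).pow (N + 1)).mul
      (hasDerivAt_cos_pow_mul_sin_pow i j θ)).congr_deriv ?_
    simp only [Pi.pow_apply, Nat.add_sub_cancel]
    push_cast
    ring
  · exact Continuous.intervalIntegrable (by fun_prop) _ _

/-- Green's formula: the two integrands differ by 1/(i+j+1) times the derivative of the periodic
function R^(i+j+1) cos^(i+1) sin^j. The sign reflects the counterclockwise orientation, and the
truncated j − 1 at j = 0 is harmless because of the factor j. -/
lemma System.lineX_eq (i j : ℕ) : s.lineX i j h = -(j * s.mom i (j - 1) h) := by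
  have h1 := System.continuous_R hh
  have h2 := System.continuous_dRθ hh
  have h0 := System.integral_deriv_eq_zero hh (i + j) (i + 1) j
  have hN : ((i + j : ℕ) : ℝ) + 1 ≠ 0 := by positivity
  have key : s.lineX i j h + j * s.mom i (j - 1) h = ((i + j : ℕ) + 1 : ℝ)⁻¹ * 0 := by
    rw [← h0, System.lineX, System.mom, ← intervalIntegral.integral_const_mul,
      ← intervalIntegral.integral_const_mul, ← intervalIntegral.integral_add
      (Continuous.intervalIntegrable (by fun_prop) _ _)
      (Continuous.intervalIntegrable (by fun_prop) _ _)]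
    refine intervalIntegral.integral_congr fun θ _ => ?_
    have hs : sin θ ^ 2 = 1 - cos θ ^ 2 := by linarith [sin_sq_add_cos_sq θ]
    rcases j with _ | j
    · simp only [Nat.cast_add, Nat.cast_zero, Nat.cast_one, add_zero, Nat.add_sub_cancel] at hN ⊢
      field_simp
      ring
    · simp only [Nat.add_sub_cancel]
      rw [show i + j + 2 = i + (j + 1) + 1 by ring]
      have e1 : sin θ ^ (j + 1 + 1) = sin θ ^ j * (1 - cos θ ^ 2) := by rw [← hs]; ring
      push_cast at hN ⊢
      rw [e1]
      field_simp
      rw [mul_pow, mul_pow]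
      linear_combination (-s.R h θ ^ (i + j + 2) * cos θ ^ i * sin θ ^ j * (i + j + 2)) * hs
  linarith

lemma System.lineY_eq (i j : ℕ) : s.lineY i j h = i * s.mom (i - 1) j h := by
  have h1 := System.continuous_R hh
  have h2 := System.continuous_dRθ hh
  have h0 := System.integral_deriv_eq_zero hh (i + j) i (j + 1)
  have hN : ((i + j : ℕ) : ℝ) + 1 ≠ 0 := by positivity
  have key : s.lineY i j h - i * s.mom (i - 1) j h = ((i + j : ℕ) + 1 : ℝ)⁻¹ * 0 := by
    rw [← h0, System.lineY, System.mom, ← intervalIntegral.integral_const_mul,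
      ← intervalIntegral.integral_const_mul, ← intervalIntegral.integral_sub
      (Continuous.intervalIntegrable (by fun_prop) _ _)
      (Continuous.intervalIntegrable (by fun_prop) _ _)]
    refine intervalIntegral.integral_congr fun θ _ => ?_
    have hc : cos θ ^ 2 = 1 - sin θ ^ 2 := by linarith [sin_sq_add_cos_sq θ]
    rcases i with _ | i
    · simp only [Nat.cast_add, Nat.cast_zero, Nat.cast_one, zero_add, Nat.add_sub_cancel] at hN ⊢
      field_simp
      ring
    · simp only [Nat.add_sub_cancel]
      rw [show i + j + 2 = i + 1 + j + 1 by ring]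
      have e1 : cos θ ^ (i + 1 + 1) = cos θ ^ i * (1 - sin θ ^ 2) := by rw [← hc]; ring
      push_cast at hN ⊢
      rw [e1]
      field_simp
      rw [mul_pow, mul_pow]
      linear_combination (s.R h θ ^ (i + j + 2) * cos θ ^ i * sin θ ^ j * (i + j + 2)) * hc
  linarith

lemma System.level_mul_lineX (i j : ℕ) :
    h * s.lineX i j h = ∑ k, s.coef k * s.lineX (s.expX k + i) (s.expY k + j) h := by
  have h1 := System.continuous_R hh
  have h2 := System.continuous_dRθ hh
  simp only [System.lineX, ← intervalIntegral.integral_const_mul]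
  rw [← intervalIntegral.integral_finsetSum
    fun k _ => Continuous.intervalIntegrable (by fun_prop) _ _]
  refine intervalIntegral.integral_congr fun θ _ => ?_
  have hH := System.H_R hh θ
  rw [System.H_eq_sum] at hH
  refine (congrArg (fun z => z * _) hH).symm.trans ?_
  rw [Finset.sum_mul]
  refine Finset.sum_congr rfl fun k _ => ?_
  ring

lemma System.level_mul_lineY (i j : ℕ) :
    h * s.lineY i j h = ∑ k, s.coef k * s.lineY (s.expX k + i) (s.expY k + j) h := by
  have h1 := System.continuous_R hh
  have h2 := System.continuous_dRθ hh
  simp only [System.lineY, ← intervalIntegral.integral_const_mul]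
  rw [← intervalIntegral.integral_finsetSum
    fun k _ => Continuous.intervalIntegrable (by fun_prop) _ _]
  refine intervalIntegral.integral_congr fun θ _ => ?_
  have hH := System.H_R hh θ
  rw [System.H_eq_sum] at hH
  refine (congrArg (fun z => z * _) hH).symm.trans ?_
  rw [Finset.sum_mul]
  refine Finset.sum_congr rfl fun k _ => ?_
  ring

/-- The relation `∮ (H - h) x ^ i y ^ j dx = 0` in terms of moments. -/
lemma System.relX (i j : ℕ) : h * (j * s.mom i (j - 1) h) =
    ∑ k, s.coef k * ((s.expY k + j : ℕ) * s.mom (s.expX k + i) (s.expY k + j - 1) h) := by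
  have := System.level_mul_lineX hh i j
  simp only [System.lineX_eq hh, mul_neg, Finset.sum_neg_distrib, neg_inj] at this
  exact this

/-- The relation `∮ (H - h) x ^ i y ^ j dy = 0` in terms of moments. -/
lemma System.relY (i j : ℕ) : h * (i * s.mom (i - 1) j h) =
    ∑ k, s.coef k * ((s.expX k + i : ℕ) * s.mom (s.expX k + i - 1) (s.expY k + j) h) := by
  have := System.level_mul_lineY hh i j
  simp only [System.lineY_eq hh] at this
  exact this

lemma System.drelX (i j : ℕ) : j * s.mom i (j - 1) h + h * (j * s.dmom i (j - 1) h) =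
    ∑ k, s.coef k * ((s.expY k + j : ℕ) * s.dmom (s.expX k + i) (s.expY k + j - 1) h) := by
  have h1 : HasDerivAt (fun h => h * (j * s.mom i (j - 1) h))
      (1 * (j * s.mom i (j - 1) h) + h * (j * s.dmom i (j - 1) h)) h :=
    (hasDerivAt_id h).mul ((System.hasDerivAt_mom hh i (j - 1)).const_mul _)
  have h2 := HasDerivAt.fun_sum (u := Finset.univ) fun (k : Fin 4) _ =>
    (((System.hasDerivAt_mom hh (s.expX k + i) (s.expY k + j - 1)).const_mul
      ((s.expY k + j : ℕ) : ℝ)).const_mul (s.coef k))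
  rw [one_mul] at h1
  refine h1.unique (h2.congr_of_eventuallyEq ?_)
  filter_upwards [s.isOpen_levels.mem_nhds hh] with y hy using System.relX hy i j

lemma System.drelY (i j : ℕ) : i * s.mom (i - 1) j h + h * (i * s.dmom (i - 1) j h) =
    ∑ k, s.coef k * ((s.expX k + i : ℕ) * s.dmom (s.expX k + i - 1) (s.expY k + j) h) := by
  have h1 : HasDerivAt (fun h => h * (i * s.mom (i - 1) j h))
      (1 * (i * s.mom (i - 1) j h) + h * (i * s.dmom (i - 1) j h)) h :=
    (hasDerivAt_id h).mul ((System.hasDerivAt_mom hh (i - 1) j).const_mul _)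
  have h2 := HasDerivAt.fun_sum (u := Finset.univ) fun (k : Fin 4) _ =>
    (((System.hasDerivAt_mom hh (s.expX k + i - 1) (s.expY k + j)).const_mul
      ((s.expX k + i : ℕ) : ℝ)).const_mul (s.coef k))
  rw [one_mul] at h1
  refine h1.unique (h2.congr_of_eventuallyEq ?_)
  filter_upwards [s.isOpen_levels.mem_nhds hh] with y hy using System.relY hy i j

lemma System.mom_zero_pos : 0 < s.mom 0 0 h := by
  have h1 := System.continuous_R hh
  refine intervalIntegral.intervalIntegral_pos_of_pos
    (Continuous.intervalIntegrable (by fun_prop) _ _) (fun θ => ?_) two_pi_pos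
  have := System.R_pos hh θ
  positivity

end

end Ovals

/-! ### V_n as the span of the moments, and moments killed or identified by symmetry -/

namespace Ovals

open Set Filter Topology Real

lemma System.ovalIntegral_eq {s : System} {h : ℝ} (hh : h ∈ s.levels) (P Q : ℝ → ℝ → ℝ) :
    s.ovalIntegral P Q h = ∫ θ in (0 : ℝ)..(2 * π),
      (P (s.R h θ * cos θ) (s.R h θ * sin θ) * (s.dRθ h θ * cos θ - s.R h θ * sin θ) +
       Q (s.R h θ * cos θ) (s.R h θ * sin θ) * (s.dRθ h θ * sin θ + s.R h θ * cos θ)) := by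
  refine intervalIntegral.integral_congr fun θ _ => ?_
  have hr : s.radius h = s.R h := funext (System.radius_eq hh)
  have h1 : deriv (fun t => (s.oval h t).1) θ = s.dRθ h θ * cos θ - s.R h θ * sin θ := by
    simp only [System.oval, hr]
    rw [((System.hasDerivAt_R_angle hh θ).fun_mul (hasDerivAt_cos θ)).deriv]
    ring
  have h2 : deriv (fun t => (s.oval h t).2) θ = s.dRθ h θ * sin θ + s.R h θ * cos θ := by
    simp only [System.oval, hr]
    rw [((System.hasDerivAt_R_angle hh θ).fun_mul (hasDerivAt_sin θ)).deriv]
  simp only [h1, h2]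
  simp only [System.oval, hr]

lemma System.ovalIntegral_monomial_dx {s : System} {h : ℝ} (hh : h ∈ s.levels) (i j : ℕ) :
    s.ovalIntegral (fun x y => x ^ i * y ^ j) (fun _ _ => 0) h = -(j * s.mom i (j - 1) h) := by
  rw [System.ovalIntegral_eq hh, ← System.lineX_eq hh, System.lineX]
  simp only [zero_mul, add_zero]

lemma System.I₁_eq {s : System} {h : ℝ} (hh : h ∈ s.levels) : s.I₁ h = -s.mom 0 0 h := by
  simpa [System.I₁] using System.ovalIntegral_monomial_dx hh 0 1

/-- The exponent of `x` in the second generator. -/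
def System.d : System → ℕ
  | .s1 => 1
  | .s2 => 1
  | _ => 2

lemma System.I₂_eq {s : System} {h : ℝ} (hh : h ∈ s.levels) : s.I₂ h = -s.mom s.d 0 h := by
  have := System.ovalIntegral_monomial_dx hh s.d 1
  cases s <;> simpa [System.d, System.I₂] using this

lemma polyFun_eq (p : MvPolynomial (Fin 2) ℝ) (x y : ℝ) :
    polyFun p x y = ∑ d ∈ p.support, p.coeff d * (x ^ d 0 * y ^ d 1) := by
  simp [polyFun, MvPolynomial.eval_eq']

lemma System.ovalIntegral_polyFun {s : System} {h : ℝ} (hh : h ∈ s.levels)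
    (f g : MvPolynomial (Fin 2) ℝ) :
    s.ovalIntegral (polyFun g) (fun x y => -polyFun f x y) h =
      -∑ d ∈ g.support, g.coeff d * (d 1 * s.mom (d 0) (d 1 - 1) h) -
        ∑ d ∈ f.support, f.coeff d * (d 0 * s.mom (d 0 - 1) (d 1) h) := by
  have h1 := System.continuous_R hh
  have h2 := System.continuous_dRθ hh
  rw [System.ovalIntegral_eq hh]
  simp only [polyFun_eq, ← System.lineY_eq hh]
  rw [← Finset.sum_neg_distrib]
  simp only [← mul_neg, ← System.lineX_eq hh, System.lineX, System.lineY,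
    ← intervalIntegral.integral_const_mul]
  rw [← intervalIntegral.integral_finsetSum
      fun k _ => Continuous.intervalIntegrable (by fun_prop) _ _,
    ← intervalIntegral.integral_finsetSum
      fun k _ => Continuous.intervalIntegrable (by fun_prop) _ _,
    ← intervalIntegral.integral_sub (Continuous.intervalIntegrable (by fun_prop) _ _)
      (Continuous.intervalIntegrable (by fun_prop) _ _)]
  refine intervalIntegral.integral_congr fun θ _ => ?_
  simp only [neg_mul, ← sub_eq_add_neg, Finset.sum_mul, mul_assoc]

/-- The moment `s.mom i j` as a function on the interval of levels. -/
noncomputable def System.M (s : System) (i j : ℕ) : s.levels → ℝ := fun h => s.mom i j h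

/-- The space spanned by the moments of degree less than `n`. -/
noncomputable def System.W (s : System) (n : ℕ) : Submodule ℝ (s.levels → ℝ) :=
  Submodule.span ℝ {I | ∃ i j, i + j < n ∧ I = s.M i j}

lemma System.M_mem_W (s : System) {i j n : ℕ} (h : i + j < n) : s.M i j ∈ s.W n :=
  Submodule.subset_span ⟨i, j, h, rfl⟩

lemma System.W_le {s : System} {n : ℕ} {T : Submodule ℝ (s.levels → ℝ)}
    (h : ∀ i j, i + j < n → s.M i j ∈ T) : s.W n ≤ T := by
  refine Submodule.span_le.2 ?_
  rintro _ ⟨i, j, hij, rfl⟩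
  exact h i j hij

lemma System.W_mono (s : System) {m n : ℕ} (h : m ≤ n) : s.W m ≤ s.W n :=
  System.W_le fun _ _ hij => s.M_mem_W (hij.trans_le h)

lemma System.V_subset_W (s : System) (n : ℕ) : s.V n ⊆ s.W n := by
  rintro I ⟨f, g, hf, hg, hI⟩
  have : I = -∑ d ∈ g.support, g.coeff d • ((d 1 : ℝ) • s.M (d 0) (d 1 - 1)) -
        ∑ d ∈ f.support, f.coeff d • ((d 0 : ℝ) • s.M (d 0 - 1) (d 1)) := by
    funext h
    rw [hI, System.ovalIntegral_polyFun h.2]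
    simp [System.M, Finset.sum_apply]
  rw [this]
  refine sub_mem (neg_mem (sum_mem fun d hd => Submodule.smul_mem _ _ ?_))
    (sum_mem fun d hd => Submodule.smul_mem _ _ ?_)
  · have hdeg := (MvPolynomial.le_totalDegree hd).trans hg
    rw [Finsupp.sum_fintype _ _ (fun _ => rfl), Fin.sum_univ_two] at hdeg
    rcases Nat.eq_zero_or_pos (d 1) with h0 | h0
    · simp [h0]
    · exact Submodule.smul_mem _ _ (s.M_mem_W (by omega))
  · have hdeg := (MvPolynomial.le_totalDegree hd).trans hf
    rw [Finsupp.sum_fintype _ _ (fun _ => rfl), Fin.sum_univ_two] at hdeg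
    rcases Nat.eq_zero_or_pos (d 0) with h0 | h0
    · simp [h0]
    · exact Submodule.smul_mem _ _ (s.M_mem_W (by omega))

/-- The linear combinations of the area integrals of degree less than `n`. -/
def System.areaCombs (s : System) (n : ℕ) : Set (s.levels → ℝ) :=
  {I | ∃ c : ℕ → ℕ → ℝ, ∀ h : s.levels,
    I h = ∑ i ∈ Finset.range n, ∑ j ∈ Finset.range (n - i), c i j * s.areaIntegral i j h}

lemma System.W_subset_areaCombs (s : System) (n : ℕ) : (s.W n : Set _) ⊆ s.areaCombs n := by
  intro I hI
  induction hI using Submodule.span_induction with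
  | mem I hI =>
    obtain ⟨a, b, hab, rfl⟩ := hI
    refine ⟨fun i j => if i = a ∧ j = b then 1 else 0, fun h => ?_⟩
    rw [Finset.sum_eq_single_of_mem a (Finset.mem_range.2 (by omega)),
      Finset.sum_eq_single_of_mem b (Finset.mem_range.2 (by omega))]
    · simp [System.M, System.areaIntegral_eq h.2]
    · intro j _ hj
      simp [hj]
    · intro i _ hi
      simp [hi]
  | zero => exact ⟨fun _ _ => 0, fun h => by simp⟩
  | add I J _ _ hI hJ =>
    obtain ⟨c, hc⟩ := hI
    obtain ⟨d, hd⟩ := hJ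
    refine ⟨fun i j => c i j + d i j, fun h => ?_⟩
    simp only [Pi.add_apply, hc, hd, add_mul, Finset.sum_add_distrib]
  | smul a I _ hI =>
    obtain ⟨c, hc⟩ := hI
    refine ⟨fun i j => a * c i j, fun h => ?_⟩
    simp only [Pi.smul_apply, hc, smul_eq_mul, Finset.mul_sum, mul_assoc]

lemma System.areaCombs_subset_W (s : System) (n : ℕ) : s.areaCombs n ⊆ s.W n := by
  rintro I ⟨c, hc⟩
  have : I = ∑ i ∈ Finset.range n, ∑ j ∈ Finset.range (n - i), c i j • s.M i j := by
    funext h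
    simp [hc, System.M, Finset.sum_apply, System.areaIntegral_eq h.2]
  rw [this]
  refine sum_mem fun i hi => sum_mem fun j hj => Submodule.smul_mem _ _ (s.M_mem_W ?_)
  simp only [Finset.mem_range] at hi hj
  omega

lemma System.zero_mem_V (s : System) (n : ℕ) : (0 : s.levels → ℝ) ∈ s.V n :=
  ⟨0, 0, by simp, by simp, fun h => by simp [System.ovalIntegral_polyFun h.2]⟩

lemma System.polyFun_linear_V {s : System} {h : ℝ} (hh : h ∈ s.levels) (a : ℝ)
    (f f' g g' : MvPolynomial (Fin 2) ℝ) :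
    s.ovalIntegral (polyFun (g + MvPolynomial.C a * g')) (fun x y =>
        -polyFun (f + MvPolynomial.C a * f') x y) h =
      s.ovalIntegral (polyFun g) (fun x y => -polyFun f x y) h +
        a * s.ovalIntegral (polyFun g') (fun x y => -polyFun f' x y) h := by
  have h1 := System.continuous_R hh
  have h2 := System.continuous_dRθ hh
  have hc : ∀ p : MvPolynomial (Fin 2) ℝ,
      Continuous fun θ => polyFun p (s.R h θ * cos θ) (s.R h θ * sin θ) := fun p => by
    simp only [polyFun_eq]
    fun_prop
  have := hc f
  have := hc f'
  have := hc g
  have := hc g'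
  rw [System.ovalIntegral_eq hh, System.ovalIntegral_eq hh, System.ovalIntegral_eq hh,
    ← intervalIntegral.integral_const_mul, ← intervalIntegral.integral_add
      (Continuous.intervalIntegrable (by fun_prop) _ _)
      (Continuous.intervalIntegrable (by fun_prop) _ _)]
  refine intervalIntegral.integral_congr fun θ _ => ?_
  simp only [polyFun, map_add, map_mul, MvPolynomial.eval_C]
  ring

lemma System.add_smul_mem_V {s : System} {n : ℕ} {I J : s.levels → ℝ} (a : ℝ) (hI : I ∈ s.V n)
    (hJ : J ∈ s.V n) : I + a • J ∈ s.V n := by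
  obtain ⟨f, g, hf, hg, hI⟩ := hI
  obtain ⟨f', g', hf', hg', hJ⟩ := hJ
  have hdeg : ∀ p q : MvPolynomial (Fin 2) ℝ, p.totalDegree ≤ n → q.totalDegree ≤ n →
      (p + MvPolynomial.C a * q).totalDegree ≤ n := fun p q hp hq => by
    refine (MvPolynomial.totalDegree_add _ _).trans (max_le hp ?_)
    refine (MvPolynomial.totalDegree_mul _ _).trans ?_
    rwa [MvPolynomial.totalDegree_C, zero_add]
  refine ⟨_, _, hdeg f f' hf hf', hdeg g g' hg hg', fun h => ?_⟩
  rw [System.polyFun_linear_V h.2, ← hI, ← hJ]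
  rfl

lemma System.M_mem_V (s : System) {i j n : ℕ} (hij : i + j < n) : s.M i j ∈ s.V n := by
  have hpos : ((i : ℝ) + 1) ≠ 0 := by positivity
  set e : Fin 2 →₀ ℕ := Finsupp.single 0 (i + 1) + Finsupp.single 1 j with he
  have h0 : e 0 = i + 1 := by simp [he]
  have h1 : e 1 = j := by simp [he]
  -- The moment is the integral of x^(i+1) y^j dy/(i+1), with a form of degree i + j + 1 ≤ n; the
  -- minus sign compensates the −f dy in the definition of `V`.
  refine ⟨MvPolynomial.monomial e (-(i + 1 : ℝ)⁻¹), 0, ?_, by simp, fun h => ?_⟩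
  · refine (MvPolynomial.totalDegree_monomial_le _ _).trans ?_
    rw [Finsupp.sum_fintype _ _ (fun _ => rfl), Fin.sum_univ_two, h0, h1]
    simp only [id]
    omega
  · rw [System.ovalIntegral_polyFun h.2, MvPolynomial.support_monomial,
      if_neg (neg_ne_zero.2 (inv_ne_zero hpos))]
    simp only [MvPolynomial.support_zero, Finset.sum_empty, Finset.sum_singleton,
      MvPolynomial.coeff_monomial, if_true, h0, h1, System.M, Nat.add_sub_cancel]
    push_cast
    field_simp
    ring

lemma System.V_eq_W (s : System) (n : ℕ) : s.V n = s.W n := by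
  refine Subset.antisymm (s.V_subset_W n) fun I hI => ?_
  induction hI using Submodule.span_induction with
  | mem I hI =>
    obtain ⟨i, j, hij, rfl⟩ := hI
    exact s.M_mem_V hij
  | zero => exact s.zero_mem_V n
  | add I J _ _ hI hJ => simpa using System.add_smul_mem_V 1 hI hJ
  | smul a I _ hI => simpa using System.add_smul_mem_V a (s.zero_mem_V n) hI

lemma System.V_eq_areaCombs (s : System) (n : ℕ) : s.V n = s.areaCombs n := by
  rw [s.V_eq_W]
  exact Subset.antisymm (s.W_subset_areaCombs n) (s.areaCombs_subset_W n)

lemma System.dimV_eq (s : System) (n : ℕ) : s.dimV n = Module.finrank ℝ (s.W n) := by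
  rw [System.dimV, s.V_eq_W, Submodule.span_eq]

lemma integral_comp_const_sub_of_periodic {F : ℝ → ℝ} (hF : Function.Periodic F (2 * π)) (a : ℝ) :
    ∫ θ in (0 : ℝ)..(2 * π), F (a - θ) = ∫ θ in (0 : ℝ)..(2 * π), F θ := by
  have := hF.intervalIntegral_add_eq (a - 2 * π) 0
  rw [intervalIntegral.integral_comp_sub_left]
  simpa using this

/-- A reflection preserving g preserves the radius. The values a = 0, π and π/2 give the symmetries
y ↦ −y, x ↦ −x and x ↔ y. -/
lemma System.mom_reflect {s : System} {a : ℝ} (hg : ∀ θ, s.g (a - θ) = s.g θ) (i j : ℕ) (h : ℝ) :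
    s.mom i j h = ∫ θ in (0 : ℝ)..(2 * π),
      s.R h θ ^ (i + j + 2) / (i + j + 2 : ℕ) * (cos (a - θ) ^ i * sin (a - θ) ^ j) := by
  have hper : Function.Periodic (fun θ =>
      s.R h θ ^ (i + j + 2) / (i + j + 2 : ℕ) * (cos θ ^ i * sin θ ^ j)) (2 * π) := fun θ => by
    simp only [s.periodic_R h θ, cos_add_two_pi, sin_add_two_pi]
  rw [System.mom, ← integral_comp_const_sub_of_periodic hper a]
  simp only [System.R, System.zArg, hg]

lemma System.g_neg (s : System) (θ : ℝ) : s.g (0 - θ) = s.g θ := by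
  cases s <;> simp [System.g]

lemma System.mom_odd_right (s : System) (i : ℕ) {j : ℕ} (hj : Odd j) (h : ℝ) : s.mom i j h = 0 := by
  have h1 := System.mom_reflect s.g_neg i j h
  simp only [zero_sub, cos_neg, sin_neg, hj.neg_pow, mul_neg, intervalIntegral.integral_neg] at h1
  rw [← System.mom] at h1
  linarith

lemma System.mom_odd_left {s : System} (he : s.e = 2) {i : ℕ} (hi : Odd i) (j : ℕ) (h : ℝ) :
    s.mom i j h = 0 := by
  have hg : ∀ θ, s.g (π - θ) = s.g θ := fun θ => by
    cases s <;> simp [System.e] at he <;> simp [System.g, Even.neg_pow (by decide : Even 4)]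
  have h1 := System.mom_reflect hg i j h
  simp only [cos_pi_sub, sin_pi_sub, hi.neg_pow, mul_neg, neg_mul,
    intervalIntegral.integral_neg] at h1
  rw [← System.mom] at h1
  linarith

lemma System.mom_swap {s : System} (hs : s = .s6 ∨ s = .s7) (i j : ℕ) (h : ℝ) :
    s.mom i j h = s.mom j i h := by
  have hg : ∀ θ, s.g (π / 2 - θ) = s.g θ := fun θ => by
    rcases hs with rfl | rfl <;>
      simp only [System.g, cos_pi_div_two_sub, sin_pi_div_two_sub, mul_comm]
  rw [System.mom_reflect hg i j h, System.mom]
  simp only [cos_pi_div_two_sub, sin_pi_div_two_sub, add_comm j i, mul_comm (cos _ ^ _)]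

/-- Here g = (2/3) cos 3θ, so the domain is invariant under rotation by 2π/3 and its centroid is the
origin. In moments, m₁₀ = −m₁₀/2 − (√3/2) m₀₁ with m₀₁ = 0. -/
lemma mom_one_zero_s3 {h : ℝ} (hh : h ∈ System.s3.levels) : System.s3.mom 1 0 h = 0 := by
  have hc := System.continuous_R hh
  have h3 : (√3 : ℝ) ^ 2 = 3 := Real.sq_sqrt (by norm_num)
  have e1 : ∀ θ, cos (θ + 2 * π / 3) = -cos θ / 2 - √3 / 2 * sin θ := fun θ => by
    rw [cos_add, show 2 * π / 3 = π - π / 3 by ring, cos_pi_sub, sin_pi_sub, cos_pi_div_three,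
      sin_pi_div_three]
    ring
  have e2 : ∀ θ, sin (θ + 2 * π / 3) = -sin θ / 2 + √3 / 2 * cos θ := fun θ => by
    rw [sin_add, show 2 * π / 3 = π - π / 3 by ring, cos_pi_sub, sin_pi_sub, cos_pi_div_three,
      sin_pi_div_three]
    ring
  have hg : ∀ θ, System.s3.g (θ + 2 * π / 3) = System.s3.g θ := fun θ => by
    simp only [System.g, e1, e2]
    linear_combination (cos θ ^ 3 / 4 - 3 / 4 * (cos θ * sin θ ^ 2) +
      √3 * cos θ ^ 2 * sin θ / 4 - √3 * sin θ ^ 3 / 12) * h3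
  have hper : Function.Periodic (fun θ =>
      System.s3.R h θ ^ (1 + 0 + 2) / (1 + 0 + 2 : ℕ) * (cos θ ^ 1 * sin θ ^ 0)) (2 * π) :=
    fun θ => by simp only [System.periodic_R _ h θ, cos_add_two_pi, sin_add_two_pi]
  have h1 := hper.intervalIntegral_add_eq (2 * π / 3) 0
  rw [zero_add, add_comm (2 * π / 3)] at h1
  change _ = System.s3.mom 1 0 h at h1
  have h2 := intervalIntegral.integral_comp_add_right (a := 0) (b := 2 * π) (fun θ =>
      System.s3.R h θ ^ (1 + 0 + 2) / (1 + 0 + 2 : ℕ) * (cos θ ^ 1 * sin θ ^ 0)) (2 * π / 3)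
  rw [zero_add, h1] at h2
  have h4 : ∫ θ in (0 : ℝ)..(2 * π), System.s3.R h (θ + 2 * π / 3) ^ (1 + 0 + 2) /
      (1 + 0 + 2 : ℕ) * (cos (θ + 2 * π / 3) ^ 1 * sin (θ + 2 * π / 3) ^ 0) =
      -1 / 2 * System.s3.mom 1 0 h + -√3 / 2 * System.s3.mom 0 1 h := by
    rw [System.mom, System.mom, ← intervalIntegral.integral_const_mul,
      ← intervalIntegral.integral_const_mul, ← intervalIntegral.integral_add
      (Continuous.intervalIntegrable (by fun_prop) _ _)
      (Continuous.intervalIntegrable (by fun_prop) _ _)]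
    refine intervalIntegral.integral_congr fun θ _ => ?_
    simp only [System.R, System.zArg, hg, e1]
    push_cast
    ring
  rw [h4, System.mom_odd_right _ 0 odd_one] at h2
  linarith

end Ovals

/-! ### Independence over the polynomials of solutions of a Fuchsian system -/

namespace Ovals

open Set Filter Topology Polynomial

section
variable {S : Set ℝ} {J₁ J₂ J₁' J₂' : ℝ → ℝ} {p q r t c : ℝ}

lemma coeff_X_mul_derivative (f : ℝ[X]) (n : ℕ) :
    (X * derivative f).coeff n = n * f.coeff n := by
  cases n with
  | zero => simp
  | succ n => rw [coeff_X_mul, coeff_derivative]; push_cast; ring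

/-- Two solutions of a Picard–Fuchs system with singular points `0` and `c`, integral exponents there,
and nonintegral exponents at infinity satisfy no relation with coprime polynomial coefficients. -/
lemma false_of_coprime_relation (hS : IsOpen S) (hne : S.Nonempty)
    (hJ₁ : ∀ h ∈ S, HasDerivAt J₁ (J₁' h) h) (hJ₂ : ∀ h ∈ S, HasDerivAt J₂ (J₂' h) h)
    (e₁ : ∀ h ∈ S, h * J₁' h = p * J₁ h + q * J₂' h)
    (e₂ : ∀ h ∈ S, (h - c) * J₂' h = r * J₂ h - t * J₁ h)
    (hpr : p + r = 2) (hpc : p * c + q * t = c) (hc : c ≠ 0) (hp : ∀ k : ℤ, p ≠ k)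
    (hpos : ∀ h ∈ S, J₁ h ≠ 0) {α β : ℝ[X]} (hαβ : IsCoprime α β)
    (rel : ∀ h ∈ S, α.eval h * J₁ h + β.eval h * J₂ h = 0) : False := by
  -- The pair (α₁, β₁) collects the coefficients of J₁ and J₂ in h(h − c) times the derivative of
  -- the relation, after `e₁` and `e₂` have removed J₁′ and J₂′.
  set α₁ : ℝ[X] := X * (X * derivative α) - C c * (X * derivative α) + C p * (X * α) - C c * α -
    C t * (X * β) with hα₁
  set β₁ : ℝ[X] := X * (X * derivative β) - C c * (X * derivative β) + C (q * r) * α +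
    C r * (X * β) with hβ₁
  have hinf : S.Infinite := infinite_of_mem_nhds hne.some (hS.mem_nhds hne.some_mem)
  have rel₁ : ∀ h ∈ S, α₁.eval h * J₁ h + β₁.eval h * J₂ h = 0 := fun h hh => by
    have hd := (((α.hasDerivAt h).mul (hJ₁ h hh)).add ((β.hasDerivAt h).mul (hJ₂ h hh))).unique
      ((hasDerivAt_const h (0 : ℝ)).congr_of_eventuallyEq
        (by filter_upwards [hS.mem_nhds hh] with y hy using rel y hy))
    have h1 := e₁ h hh
    have h2 := e₂ h hh
    simp only [hα₁, hβ₁, eval_add, eval_sub, eval_mul, eval_X, eval_C]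
    linear_combination (h * (h - c)) * hd - (α.eval h * (h - c)) * h1 -
      (β.eval h * h + α.eval h * q) * h2 + α.eval h * J₁ h * hpc
  -- Both relations annihilate (J₁, J₂) with J₁ ≠ 0, so their determinant vanishes at infinitely
  -- many levels.
  have hdet : α₁ * β = β₁ * α := by
    rw [← sub_eq_zero]
    refine eq_zero_of_infinite_isRoot _ (hinf.mono fun h hh => ?_)
    have := mul_eq_zero.1 (show (α₁ * β - β₁ * α).eval h * J₁ h = 0 by
      simp only [eval_sub, eval_mul]
      linear_combination β.eval h * rel₁ h hh - β₁.eval h * rel h hh)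
    exact this.resolve_right (hpos h hh)
  -- By coprimality the proportional pair (α₁, β₁) is a polynomial multiple l of (α, β).
  obtain ⟨u, v, huv⟩ := hαβ
  set l := u * α₁ + v * β₁ with hl
  have hlα : l * α = α₁ := by
    rw [hl]
    linear_combination α₁ * huv - v * hdet
  have hlβ : l * β = β₁ := by
    rw [hl]
    linear_combination β₁ * huv + u * hdet
  have cα : ∀ n, α₁.coeff (n + 1) = n * α.coeff n - c * ((n + 1) * α.coeff (n + 1)) +
      p * α.coeff n - c * α.coeff (n + 1) - t * β.coeff n := fun n => by
    simp only [hα₁, coeff_add, coeff_sub, coeff_C_mul, coeff_X_mul, coeff_X_mul_derivative]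
    rw [← coeff_X_mul (derivative α) n, coeff_X_mul_derivative]
    push_cast
    ring
  have cβ : ∀ n, β₁.coeff (n + 1) = n * β.coeff n - c * ((n + 1) * β.coeff (n + 1)) +
      q * r * α.coeff (n + 1) + r * β.coeff n := fun n => by
    simp only [hβ₁, coeff_add, coeff_sub, coeff_C_mul, coeff_X_mul, coeff_X_mul_derivative]
    rw [← coeff_X_mul (derivative β) n, coeff_X_mul_derivative]
    push_cast
    ring
  -- N is the larger of the two degrees; passing to (α₁, β₁) raises it by at most one, whence the
  -- bound on l.
  have hN : ∃ N, (∀ n, N < n → α.coeff n = 0 ∧ β.coeff n = 0) ∧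
      (α.coeff N ≠ 0 ∨ β.coeff N ≠ 0) ∧ l.natDegree ≤ 1 := by
    have hα₁deg : ∀ N, (∀ n, N < n → α.coeff n = 0 ∧ β.coeff n = 0) → α₁.natDegree ≤ N + 1 :=
      fun N hN => natDegree_le_iff_coeff_eq_zero.2 fun n hn => by
        obtain ⟨n, rfl⟩ : ∃ k, n = k + 1 := ⟨n - 1, by omega⟩
        rw [cα, (hN n (by omega)).1, (hN n (by omega)).2, (hN (n + 1) (by omega)).1]
        ring
    have hβ₁deg : ∀ N, (∀ n, N < n → α.coeff n = 0 ∧ β.coeff n = 0) → β₁.natDegree ≤ N + 1 :=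
      fun N hN => natDegree_le_iff_coeff_eq_zero.2 fun n hn => by
        obtain ⟨n, rfl⟩ : ∃ k, n = k + 1 := ⟨n - 1, by omega⟩
        rw [cβ, (hN n (by omega)).2, (hN (n + 1) (by omega)).1, (hN (n + 1) (by omega)).2]
        ring
    have hlarge : ∀ n, max α.natDegree β.natDegree < n → α.coeff n = 0 ∧ β.coeff n = 0 :=
      fun n hn => ⟨coeff_eq_zero_of_natDegree_lt (lt_of_le_of_lt (le_max_left _ _) hn),
        coeff_eq_zero_of_natDegree_lt (lt_of_le_of_lt (le_max_right _ _) hn)⟩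
    refine ⟨max α.natDegree β.natDegree, hlarge, ?_⟩
    have hα₁' := hα₁deg _ hlarge
    have hβ₁' := hβ₁deg _ hlarge
    by_cases hl0 : l = 0
    · rw [hl0, natDegree_zero]
      refine ⟨?_, zero_le_one⟩
      rcases le_or_gt β.natDegree α.natDegree with hle | hlt
      · rw [max_eq_left hle]
        by_cases hα0 : α = 0
        · right
          have : β.natDegree = 0 := by rw [hα0, natDegree_zero] at hle; omega
          have hβ0 : β ≠ 0 := fun h => by simp [h, hα0] at huv
          rw [hα0, natDegree_zero, ← this]
          exact leadingCoeff_ne_zero.2 hβ0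
        · exact Or.inl (leadingCoeff_ne_zero.2 hα0)
      · rw [max_eq_right hlt.le]
        exact Or.inr (leadingCoeff_ne_zero.2 fun h => by simp [h] at hlt)
    · rcases le_or_gt β.natDegree α.natDegree with hle | hlt
      · rw [max_eq_left hle] at hα₁' hβ₁' ⊢
        by_cases hα0 : α = 0
        · have h0 : β.natDegree = 0 := by rw [hα0, natDegree_zero] at hle; omega
          have hβ0 : β ≠ 0 := fun h => by simp [h, hα0] at huv
          rw [← hlβ, natDegree_mul hl0 hβ0] at hβ₁'
          refine ⟨Or.inr ?_, ?_⟩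
          · rw [hα0, natDegree_zero, ← h0]
            exact leadingCoeff_ne_zero.2 hβ0
          · rw [hα0, natDegree_zero] at hβ₁'
            omega
        · rw [← hlα, natDegree_mul hl0 hα0] at hα₁'
          exact ⟨Or.inl (leadingCoeff_ne_zero.2 hα0), by omega⟩
      · have hβ0 : β ≠ 0 := fun h => by simp [h] at hlt
        rw [max_eq_right hlt.le] at hβ₁' ⊢
        rw [← hlβ, natDegree_mul hl0 hβ0] at hβ₁'
        exact ⟨Or.inr (leadingCoeff_ne_zero.2 hβ0), by omega⟩
  obtain ⟨N, hlarge, hlead, hdeg⟩ := hN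
  obtain ⟨l1, l0, hll⟩ := exists_eq_X_add_C_of_natDegree_le_one hdeg
  have hzero := hlarge (N + 1) (by omega)
  have i1 : l1 * α.coeff N = (N + p) * α.coeff N - t * β.coeff N := by
    have := cα N
    rw [← hlα, hll, add_mul, mul_assoc, coeff_add, coeff_C_mul, coeff_X_mul, coeff_C_mul,
      hzero.1] at this
    linear_combination this
  have i2 : l1 * β.coeff N = (N + r) * β.coeff N := by
    have := cβ N
    rw [← hlβ, hll, add_mul, mul_assoc, coeff_add, coeff_C_mul, coeff_X_mul, coeff_C_mul,
      hzero.1, hzero.2] at this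
    linear_combination this
  -- Exponents at infinity: the leading coefficients form an eigenvector of a triangular matrix with
  -- diagonal N + p, N + r.
  have hlinf : l1 = N + p ∨ l1 = N + r := by
    by_cases hb : β.coeff N = 0
    · rw [hb, mul_zero, sub_zero] at i1
      exact Or.inl (mul_right_cancel₀ (hlead.resolve_right (not_not.2 hb)) i1)
    · exact Or.inr (mul_right_cancel₀ hb i2)
  have evα : ∀ h, (l1 * h + l0) * α.eval h = α₁.eval h := fun h => by
    rw [← hlα, hll]; simp
  have evβ : ∀ h, (l1 * h + l0) * β.eval h = β₁.eval h := fun h => by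
    rw [← hlβ, hll]; simp
  have evuv : ∀ h, u.eval h * α.eval h + v.eval h * β.eval h = 1 := fun h => by
    have := congrArg (eval h) huv
    simpa using this
  -- Exponents at 0: there α₁ = −cα and β₁ = qrα.
  have hl0 : l0 = 0 ∨ l0 = -c := by
    have a0 := evα 0
    have b0 := evβ 0
    simp only [hα₁, hβ₁, eval_add, eval_sub, eval_mul, eval_X, eval_C] at a0 b0
    by_cases ha : α.eval 0 = 0
    · left
      have hb : β.eval 0 ≠ 0 := fun hb => by simpa [ha, hb] using evuv 0
      rw [ha] at b0
      exact (mul_eq_zero.1 (show l0 * β.eval 0 = 0 by linear_combination b0)).resolve_right hb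
    · right
      exact mul_right_cancel₀ ha (by linear_combination a0)
  -- Exponents at c: with w = qα + cβ one has α₁ = −tw and β₁ = rw there, and qα₁ + cβ₁ = cw by
  -- `hpr` and `hpc`.
  have hlc : l1 * c + l0 = 0 ∨ l1 * c + l0 = c := by
    have a0 := evα c
    have b0 := evβ c
    simp only [hα₁, hβ₁, eval_add, eval_sub, eval_mul, eval_X, eval_C] at a0 b0
    by_cases hw : q * α.eval c + c * β.eval c = 0
    · left
      have ha : (l1 * c + l0) * α.eval c = 0 := by
        linear_combination a0 - t * hw + α.eval c * hpc
      have hb : (l1 * c + l0) * β.eval c = 0 := by linear_combination b0 + r * hw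
      linear_combination u.eval c * ha + v.eval c * hb - (l1 * c + l0) * evuv c
    · right
      refine mul_right_cancel₀ hw ?_
      linear_combination q * a0 + c * b0 + (c * hpr - hpc) * (q * α.eval c + c * β.eval c) +
        (q * α.eval c) * hpc
  -- l1 is the increment of l from 0 to c divided by c. Being an integer, it contradicts `hlinf`,
  -- since neither p nor r = 2 − p is one.
  have hl1 : l1 = 0 ∨ l1 = 1 ∨ l1 = 2 := by
    rcases hl0 with h0 | h0 <;> rcases hlc with h1 | h1
    · exact Or.inl (mul_right_cancel₀ hc (by linear_combination h1 - h0))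
    · exact Or.inr (Or.inl (mul_right_cancel₀ hc (by linear_combination h1 - h0)))
    · exact Or.inr (Or.inl (mul_right_cancel₀ hc (by linear_combination h1 - h0)))
    · exact Or.inr (Or.inr (mul_right_cancel₀ hc (by linear_combination h1 - h0)))
  have hint : ∃ k : ℤ, l1 = k := by
    rcases hl1 with h | h | h
    exacts [⟨0, by simp [h]⟩, ⟨1, by simp [h]⟩, ⟨2, by simp [h]⟩]
  obtain ⟨k, hk⟩ := hint
  rcases hlinf with h | h
  · exact hp (k - N) (by push_cast; linarith)
  · exact hp (N + 2 - k) (by push_cast; linarith)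

/-- Two solutions of a Picard–Fuchs system with singular points `0` and `c`, integral exponents there,
and nonintegral exponents at infinity are independent over the polynomials. -/
lemma relation_trivial (hS : IsOpen S) (hne : S.Nonempty)
    (hJ₁ : ∀ h ∈ S, HasDerivAt J₁ (J₁' h) h) (hJ₂ : ∀ h ∈ S, HasDerivAt J₂ (J₂' h) h)
    (e₁ : ∀ h ∈ S, h * J₁' h = p * J₁ h + q * J₂' h)
    (e₂ : ∀ h ∈ S, (h - c) * J₂' h = r * J₂ h - t * J₁ h)
    (hpr : p + r = 2) (hpc : p * c + q * t = c) (hc : c ≠ 0) (hp : ∀ k : ℤ, p ≠ k)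
    (hpos : ∀ h ∈ S, J₁ h ≠ 0) {α β : ℝ[X]}
    (rel : ∀ h ∈ S, α.eval h * J₁ h + β.eval h * J₂ h = 0) : α = 0 ∧ β = 0 := by
  by_contra hcon
  have hg0 : gcd α β ≠ 0 := fun h => hcon ((gcd_eq_zero_iff α β).1 h)
  obtain ⟨α', hα'⟩ := gcd_dvd_left α β
  obtain ⟨β', hβ'⟩ := gcd_dvd_right α β
  have hcop : IsCoprime α' β' := by
    obtain ⟨u, v, huv⟩ := exists_gcd_eq_mul_add_mul α β
    refine ⟨u, v, mul_left_cancel₀ hg0 ?_⟩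
    calc gcd α β * (u * α' + v * β') = (gcd α β * α') * u + (gcd α β * β') * v := by ring
      _ = gcd α β * 1 := by rw [← hα', ← hβ', mul_one, ← huv]
  have hinf : S.Infinite := infinite_of_mem_nhds hne.some (hS.mem_nhds hne.some_mem)
  -- The common factor can be cancelled only off its zeros, which leave a nonempty open set of
  -- levels.
  have hS' : IsOpen (S ∩ {h | (gcd α β).eval h ≠ 0}) :=
    hS.inter (isOpen_ne_fun (gcd α β).continuous continuous_const)
  have hne' : (S ∩ {h | (gcd α β).eval h ≠ 0}).Nonempty := by
    by_contra hemp
    refine hg0 (eq_zero_of_infinite_isRoot _ (hinf.mono fun h hh => ?_))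
    by_contra hr
    exact hemp ⟨h, hh, hr⟩
  refine false_of_coprime_relation hS' hne' (fun h hh => hJ₁ h hh.1) (fun h hh => hJ₂ h hh.1)
    (fun h hh => e₁ h hh.1) (fun h hh => e₂ h hh.1) hpr hpc hc hp (fun h hh => hpos h hh.1) hcop
    fun h hh => mul_left_cancel₀ hh.2 ?_
  have h1 := rel h hh.1
  have h2 := congrArg (eval h) hα'
  have h3 := congrArg (eval h) hβ'
  rw [eval_mul] at h2 h3
  rw [h2, h3] at h1
  linear_combination h1

end

end Ovals

/-! ### The Picard–Fuchs system of each Hamiltonian -/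

namespace Ovals

open Set Filter Topology Polynomial

section
variable {s : System} {h : ℝ} (hh : h ∈ s.levels)
include hh

/-- Differentiating `relX` in h leaves a multiple of h `dmom i j`, which `coarea` cancels. The
remaining sum is the moment derivative of x^i y^j · y ∂H/∂y. -/
lemma System.gradY (i j : ℕ) : (j + 1 : ℝ) * s.mom i j h =
    ∑ k, s.coef k * (s.expY k * s.dmom (s.expX k + i) (s.expY k + j) h) := by
  have h1 := System.drelX hh i (j + 1)
  have h2 := System.coarea hh i j
  simp only [Nat.add_sub_cancel, ← add_assoc] at h1
  have : ∑ k, s.coef k * ((s.expY k + j + 1 : ℕ) * s.dmom (s.expX k + i) (s.expY k + j) h) =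
      ∑ k, s.coef k * (s.expY k * s.dmom (s.expX k + i) (s.expY k + j) h) +
      (j + 1) * ∑ k, s.coef k * s.dmom (s.expX k + i) (s.expY k + j) h := by
    rw [Finset.mul_sum, ← Finset.sum_add_distrib]
    exact Finset.sum_congr rfl fun k _ => by push_cast; ring
  rw [this, ← h2] at h1
  push_cast at h1
  linarith

lemma System.gradX (i j : ℕ) : (i + 1 : ℝ) * s.mom i j h =
    ∑ k, s.coef k * (s.expX k * s.dmom (s.expX k + i) (s.expY k + j) h) := by
  have h1 := System.drelY hh (i + 1) j
  have h2 := System.coarea hh i j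
  simp only [Nat.add_sub_cancel, ← add_assoc] at h1
  have : ∑ k, s.coef k * ((s.expX k + i + 1 : ℕ) * s.dmom (s.expX k + i) (s.expY k + j) h) =
      ∑ k, s.coef k * (s.expX k * s.dmom (s.expX k + i) (s.expY k + j) h) +
      (i + 1) * ∑ k, s.coef k * s.dmom (s.expX k + i) (s.expY k + j) h := by
    rw [Finset.mul_sum, ← Finset.sum_add_distrib]
    exact Finset.sum_congr rfl fun k _ => by push_cast; ring
  rw [this, ← h2] at h1
  push_cast at h1
  linarith

lemma System.dmom_eq_of_mom_eq {i j k l : ℕ} {a : ℝ}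
    (heq : ∀ h ∈ s.levels, s.mom i j h = a * s.mom k l h) :
    s.dmom i j h = a * s.dmom k l h :=
  (System.hasDerivAt_mom hh i j).unique
    (((System.hasDerivAt_mom hh k l).const_mul a).congr_of_eventuallyEq
      (by filter_upwards [s.isOpen_levels.mem_nhds hh] with y hy using heq y hy))

end

/-- The integral of ∂H/∂x over the domain vanishes, which reads m₁₀ − m₂₀ + m₀₂ = 0, and m₁₀ = 0 by
symmetry. -/
lemma mom_two_zero_s3 {h : ℝ} (hh : h ∈ System.s3.levels) :
    System.s3.mom 2 0 h = System.s3.mom 0 2 h := by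
  have h1 := System.relX hh 0 1
  have h2 := System.relX hh 1 0
  have h3 := System.relY hh 1 0
  have h4 := System.relY hh 0 1
  have h5 := mom_one_zero_s3 hh
  have h6 := System.relX hh 0 0
  have h7 := System.relY hh 0 0
  simp only [System.coef, System.expX, System.expY, Fin.sum_univ_four, Matrix.cons_val] at h1 h2 h3 h4 h6 h7
  norm_num at h1 h2 h3 h4 h5 h6 h7
  linarith

lemma ne_int_of_between {p : ℝ} (h0 : 0 < p) (h1 : p < 1) (k : ℤ) : p ≠ k := by
  rintro rfl
  have h0' : 0 < k := by exact_mod_cast h0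
  have h1' : k < 1 := by exact_mod_cast h1
  omega

lemma System.nonempty_levels (s : System) : s.levels.Nonempty := by
  cases s <;> simp [System.levels]

/-- The Picard–Fuchs system of the two generators. -/
lemma System.exists_picardFuchs (s : System) : ∃ p q r t c : ℝ, p + r = 2 ∧ p * c + q * t = c ∧
    c ≠ 0 ∧ 0 < p ∧ p < 1 ∧ ∀ h ∈ s.levels,
      h * s.dmom 0 0 h = p * s.mom 0 0 h + q * s.dmom s.d 0 h ∧
      (h - c) * s.dmom s.d 0 h = r * s.mom s.d 0 h - t * s.mom 0 0 h := by
  -- In each case c is the nonzero critical value of H, attained at complex critical points for `s4`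
  -- and `s6`. The other constants come from eliminating the remaining moment derivatives between
  -- `coarea` and the gradient relations.
  cases s
  · refine ⟨5 / 6, 2 / 9, 7 / 6, 1 / 9, 4 / 27, by norm_num, by norm_num, by norm_num, by norm_num,
      by norm_num, fun h hh => ?_⟩
    have h1 := System.coarea hh 0 0
    have h2 := System.gradX hh 0 0
    have h3 := System.gradY hh 0 0
    have h4 := System.coarea hh 1 0
    have h5 := System.gradX hh 1 0
    have h6 := System.gradY hh 1 0
    -- At i = 0 this is the derivative of ∬ ∂H/∂x = 0, which ties another moment derivative to that
    -- of `mom 1 0`.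
    have h7 := System.drelY hh 0 0
    simp only [System.coef, System.expX, System.expY, Fin.sum_univ_four, Matrix.cons_val, System.d]
      at h1 h2 h3 h4 h5 h6 h7 ⊢
    norm_num at h1 h2 h3 h4 h5 h6 h7 ⊢
    constructor <;> linarith
  · refine ⟨3 / 4, 1, 5 / 4, 1 / 4, 1, by norm_num, by norm_num, by norm_num, by norm_num,
      by norm_num, fun h hh => ?_⟩
    have h1 := System.coarea hh 0 0
    have h2 := System.gradX hh 0 0
    have h3 := System.gradY hh 0 0
    have h4 := System.coarea hh 1 0
    have h5 := System.gradX hh 1 0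
    have h6 := System.gradY hh 1 0
    have h7 := System.drelY hh 0 0
    simp only [System.coef, System.expX, System.expY, Fin.sum_univ_four, Matrix.cons_val, System.d]
      at h1 h2 h3 h4 h5 h6 h7 ⊢
    norm_num at h1 h2 h3 h4 h5 h6 h7 ⊢
    constructor <;> linarith
  · refine ⟨2 / 3, 1 / 3, 4 / 3, 1 / 6, 1 / 6, by norm_num, by norm_num, by norm_num, by norm_num,
      by norm_num, fun h hh => ?_⟩
    have h0 : System.s3.dmom 2 0 h = System.s3.dmom 0 2 h := by
      simpa using System.dmom_eq_of_mom_eq hh (a := 1)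
        (fun h hh => by rw [one_mul]; exact mom_two_zero_s3 hh)
    have h1 := System.coarea hh 0 0
    have h2 := System.gradX hh 0 0
    have h3 := System.gradY hh 0 0
    have h4 := System.coarea hh 2 0
    have h5 := System.gradX hh 2 0
    have h6 := System.gradY hh 2 0
    have h7 := System.gradX hh 1 0
    have h8 := System.gradY hh 1 0
    have h9 := mom_one_zero_s3 hh
    simp only [System.coef, System.expX, System.expY, Fin.sum_univ_four, Matrix.cons_val, System.d]
      at h1 h2 h3 h4 h5 h6 h7 h8 ⊢
    norm_num at h1 h2 h3 h4 h5 h6 h7 h8 ⊢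
    constructor <;> linarith
  · refine ⟨3 / 4, 1 / 2, 5 / 4, -1 / 8, -1 / 4, by norm_num, by norm_num, by norm_num, by norm_num,
      by norm_num, fun h hh => ?_⟩
    have h1 := System.coarea hh 0 0
    have h2 := System.gradX hh 0 0
    have h3 := System.gradY hh 0 0
    have h4 := System.coarea hh 2 0
    have h5 := System.gradX hh 2 0
    have h6 := System.gradY hh 2 0
    simp only [System.coef, System.expX, System.expY, Fin.sum_univ_four, Matrix.cons_val, System.d]
      at h1 h2 h3 h4 h5 h6 ⊢
    norm_num at h1 h2 h3 h4 h5 h6 ⊢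
    constructor <;> linarith
  · refine ⟨3 / 4, 1 / 2, 5 / 4, 1 / 8, 1 / 4, by norm_num, by norm_num, by norm_num, by norm_num,
      by norm_num, fun h hh => ?_⟩
    have h1 := System.coarea hh 0 0
    have h2 := System.gradX hh 0 0
    have h3 := System.gradY hh 0 0
    have h4 := System.coarea hh 2 0
    have h5 := System.gradX hh 2 0
    have h6 := System.gradY hh 2 0
    simp only [System.coef, System.expX, System.expY, Fin.sum_univ_four, Matrix.cons_val, System.d]
      at h1 h2 h3 h4 h5 h6 ⊢
    norm_num at h1 h2 h3 h4 h5 h6 ⊢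
    constructor <;> linarith
  · refine ⟨1 / 2, 1, 3 / 2, -1 / 2, -1, by norm_num, by norm_num, by norm_num, by norm_num,
      by norm_num, fun h hh => ?_⟩
    have h1 := System.coarea hh 0 0
    have h2 := System.gradX hh 0 0
    have h3 := System.gradY hh 0 0
    have h4 := System.coarea hh 2 0
    have h5 := System.gradX hh 2 0
    have h6 := System.gradY hh 2 0
    simp only [System.coef, System.expX, System.expY, Fin.sum_univ_four, Matrix.cons_val, System.d]
      at h1 h2 h3 h4 h5 h6 ⊢
    norm_num at h1 h2 h3 h4 h5 h6 ⊢
    constructor <;> linarith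
  · refine ⟨1 / 2, 1, 3 / 2, 1 / 2, 1, by norm_num, by norm_num, by norm_num, by norm_num,
      by norm_num, fun h hh => ?_⟩
    have h1 := System.coarea hh 0 0
    have h2 := System.gradX hh 0 0
    have h3 := System.gradY hh 0 0
    have h4 := System.coarea hh 2 0
    have h5 := System.gradX hh 2 0
    have h6 := System.gradY hh 2 0
    simp only [System.coef, System.expX, System.expY, Fin.sum_univ_four, Matrix.cons_val, System.d]
      at h1 h2 h3 h4 h5 h6 ⊢
    norm_num at h1 h2 h3 h4 h5 h6 ⊢
    constructor <;> linarith

lemma System.eq_zero_of_relation (s : System) {α β : ℝ[X]}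
    (rel : ∀ h ∈ s.levels, α.eval h * s.mom 0 0 h + β.eval h * s.mom s.d 0 h = 0) :
    α = 0 ∧ β = 0 := by
  obtain ⟨p, q, r, t, c, h1, h2, h3, h4, h5, h6⟩ := s.exists_picardFuchs
  exact relation_trivial s.isOpen_levels s.nonempty_levels
    (fun h hh => System.hasDerivAt_mom hh 0 0) (fun h hh => System.hasDerivAt_mom hh s.d 0)
    (fun h hh => (h6 h hh).1) (fun h hh => (h6 h hh).2) h1 h2 h3 (ne_int_of_between h4 h5)
    (fun h hh => (System.mom_zero_pos hh).ne') rel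

end Ovals

/-! ### Linear algebra of spans of two sequences -/

namespace Ovals

open Set Polynomial

section
variable {E : Type*} [AddCommGroup E] [Module ℝ E]

/-- The linear map sending the `k`-th coefficients of a pair of polynomials to multiples of `u k` and
of `v k`. -/
noncomputable def seqMap (u v : ℕ → E) : ℝ[X] × ℝ[X] →ₗ[ℝ] E :=
  ((Polynomial.basisMonomials ℝ).constr ℝ u).coprod ((Polynomial.basisMonomials ℝ).constr ℝ v)

/-- The span of the first `a` terms of `u` and the first `b` terms of `v`. -/
def seqSpan (u v : ℕ → E) (a b : ℕ) : Submodule ℝ E :=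
  Submodule.span ℝ (u '' Iio a) ⊔ Submodule.span ℝ (v '' Iio b)

variable {u v : ℕ → E} {a b : ℕ}

lemma constr_monomials (u : ℕ → E) (p : ℝ[X]) :
    (Polynomial.basisMonomials ℝ).constr ℝ u p = p.sum fun k c => c • u k := by
  rw [Module.Basis.constr_apply]
  rfl

lemma constr_X_pow (u : ℕ → E) (k : ℕ) : (Polynomial.basisMonomials ℝ).constr ℝ u (X ^ k) = u k := by
  rw [constr_monomials, ← monomial_one_right_eq_X_pow, sum_monomial_index _ _ (by simp), one_smul]

lemma map_degreeLT (u : ℕ → E) (a : ℕ) :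
    (degreeLT ℝ a).map ((Polynomial.basisMonomials ℝ).constr ℝ u) =
      Submodule.span ℝ (u '' Iio a) := by
  classical
  rw [degreeLT_eq_span_X_pow, Submodule.map_span]
  congr 1
  ext f
  simp [constr_X_pow]

lemma seqSpan_eq_map (u v : ℕ → E) (a b : ℕ) :
    seqSpan u v a b = ((degreeLT ℝ a).prod (degreeLT ℝ b)).map (seqMap u v) := by
  rw [seqMap, LinearMap.map_coprod_prod, map_degreeLT, map_degreeLT, seqSpan]

lemma mem_seqSpan_left {k : ℕ} (h : k < a) : u k ∈ seqSpan u v a b :=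
  Submodule.mem_sup_left (Submodule.subset_span ⟨k, h, rfl⟩)

lemma mem_seqSpan_right {k : ℕ} (h : k < b) : v k ∈ seqSpan u v a b :=
  Submodule.mem_sup_right (Submodule.subset_span ⟨k, h, rfl⟩)

lemma seqSpan_le {T : Submodule ℝ E} (hu : ∀ k < a, u k ∈ T) (hv : ∀ k < b, v k ∈ T) :
    seqSpan u v a b ≤ T := by
  refine sup_le (Submodule.span_le.2 ?_) (Submodule.span_le.2 ?_)
  · rintro _ ⟨k, hk, rfl⟩; exact hu k hk
  · rintro _ ⟨k, hk, rfl⟩; exact hv k hk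

lemma seqSpan_mono {a' b' : ℕ} (ha : a ≤ a') (hb : b ≤ b') :
    seqSpan u v a b ≤ seqSpan u v a' b' :=
  seqSpan_le (fun _ hk => mem_seqSpan_left (hk.trans_le ha))
    fun _ hk => mem_seqSpan_right (hk.trans_le hb)

lemma finrank_seqSpan (hinj : Function.Injective (seqMap u v)) (a b : ℕ) :
    Module.finrank ℝ (seqSpan u v a b) = a + b := by
  set f : (degreeLT ℝ a × degreeLT ℝ b) →ₗ[ℝ] E :=
    seqMap u v ∘ₗ (degreeLT ℝ a).subtype.prodMap (degreeLT ℝ b).subtype with hf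
  have hfin : Function.Injective f := hinj.comp
    (Function.Injective.prodMap Subtype.val_injective Subtype.val_injective)
  have hr : LinearMap.range f = seqSpan u v a b := by
    rw [hf, LinearMap.range_comp, LinearMap.range_prodMap, Submodule.range_subtype,
      Submodule.range_subtype, seqSpan_eq_map]
  rw [← hr, LinearMap.finrank_range_of_inj hfin, ← ((degreeLTEquiv ℝ a).prodCongr
    (degreeLTEquiv ℝ b)).symm.finrank_eq]
  simp

/-- If `a • u k + b • v k` lies in the span of the previous terms, then `a = b = 0`. -/
lemma eq_zero_of_smul_add_mem (hinj : Function.Injective (seqMap u v)) {k : ℕ} {c d : ℝ}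
    (h : c • u k + d • v k ∈ seqSpan u v k k) : c = 0 ∧ d = 0 := by
  rw [seqSpan_eq_map] at h
  obtain ⟨⟨ξ, η⟩, ⟨hξ, hη⟩, heq⟩ := h
  have h1 : seqMap u v (c • X ^ k, d • X ^ k) = c • u k + d • v k := by
    simp [seqMap, constr_X_pow]
  have h2 := hinj (heq.trans h1.symm)
  simp only [Prod.mk.injEq] at h2
  have hξk := coeff_eq_zero_of_degree_lt (mem_degreeLT.1 hξ)
  have hηk := coeff_eq_zero_of_degree_lt (mem_degreeLT.1 hη)
  simp only at hξk hηk
  rw [h2.1] at hξk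
  rw [h2.2] at hηk
  simpa using And.intro hξk hηk

/-- A sequence of pairs with independent leading terms gives an injective map. -/
lemma seqMap_injective_of_lead (hinj : Function.Injective (seqMap u v)) {u' v' : ℕ → E}
    {cu du cv dv : ℕ → ℝ} (hu : ∀ k, u' k - (cu k • u k + du k • v k) ∈ seqSpan u v k k)
    (hv : ∀ k, v' k - (cv k • u k + dv k • v k) ∈ seqSpan u v k k)
    (hdet : ∀ k, cu k * dv k - cv k * du k ≠ 0) : Function.Injective (seqMap u' v') := by
  -- The family is block triangular: the top index of a relation is killed by its nonzero 2×2
  -- determinant, and induction handles the rest.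
  have key : ∀ K, ∀ x y : ℕ → ℝ, ∑ k ∈ Finset.range K, (x k • u' k + y k • v' k) = 0 →
      ∀ k < K, x k = 0 ∧ y k = 0 := by
    have hu1 : ∀ k, u' k ∈ seqSpan u v (k + 1) (k + 1) := fun k => by
      have h1 := seqSpan_mono (Nat.le_succ k) (Nat.le_succ k) (hu k)
      have h2 : cu k • u k + du k • v k ∈ seqSpan u v (k + 1) (k + 1) :=
        add_mem (Submodule.smul_mem _ _ (mem_seqSpan_left k.lt_succ_self))
          (Submodule.smul_mem _ _ (mem_seqSpan_right k.lt_succ_self))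
      simpa using add_mem h1 h2
    have hv1 : ∀ k, v' k ∈ seqSpan u v (k + 1) (k + 1) := fun k => by
      have h1 := seqSpan_mono (Nat.le_succ k) (Nat.le_succ k) (hv k)
      have h2 : cv k • u k + dv k • v k ∈ seqSpan u v (k + 1) (k + 1) :=
        add_mem (Submodule.smul_mem _ _ (mem_seqSpan_left k.lt_succ_self))
          (Submodule.smul_mem _ _ (mem_seqSpan_right k.lt_succ_self))
      simpa using add_mem h1 h2
    intro K
    induction K with
    | zero => intro x y _ k hk; omega
    | succ K ih =>
      intro x y hsum k hk
      rw [Finset.sum_range_succ] at hsum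
      have hlow : ∑ k ∈ Finset.range K, (x k • u' k + y k • v' k) ∈ seqSpan u v K K :=
        sum_mem fun j hj => by
          have hjK : j + 1 ≤ K := Finset.mem_range.1 hj
          exact add_mem (Submodule.smul_mem _ _ (seqSpan_mono hjK hjK (hu1 j)))
            (Submodule.smul_mem _ _ (seqSpan_mono hjK hjK (hv1 j)))
      have hlead : (x K * cu K + y K * cv K) • u K + (x K * du K + y K * dv K) • v K ∈
          seqSpan u v K K := by
        have h1 := Submodule.smul_mem _ (x K) (hu K)
        have h2 := Submodule.smul_mem _ (y K) (hv K)
        have h3 := neg_mem (add_mem (add_mem h1 h2) hlow)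
        convert h3 using 1
        rw [← sub_eq_zero, ← hsum]
        module
      obtain ⟨h1, h2⟩ := eq_zero_of_smul_add_mem hinj hlead
      have hx : x K = 0 := (mul_eq_zero.1 (show x K * (cu K * dv K - cv K * du K) = 0 by
        linear_combination dv K * h1 - cv K * h2)).resolve_right (hdet K)
      have hy : y K = 0 := (mul_eq_zero.1 (show y K * (cu K * dv K - cv K * du K) = 0 by
        linear_combination cu K * h2 - du K * h1)).resolve_right (hdet K)
      rcases Nat.lt_succ_iff_lt_or_eq.1 hk with hlt | rfl
      · refine ih x y ?_ k hlt
        simpa [hx, hy] using hsum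
      · exact ⟨hx, hy⟩
  rw [← LinearMap.ker_eq_bot, LinearMap.ker_eq_bot']
  rintro ⟨ξ, η⟩ h0
  set K := max ξ.natDegree η.natDegree + 1 with hK
  have hsum : ∑ k ∈ Finset.range K, (ξ.coeff k • u' k + η.coeff k • v' k) = 0 := by
    rw [Finset.sum_add_distrib, ← h0, seqMap, LinearMap.coprod_apply, constr_monomials,
      constr_monomials, sum_over_range' _ (by simp) K (Nat.lt_succ_of_le (le_max_left _ _)),
      sum_over_range' _ (by simp) K (Nat.lt_succ_of_le (le_max_right _ _))]
  have hz := key K ξ.coeff η.coeff hsum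
  have hξ : ξ = 0 := by
    ext k
    rcases lt_or_ge k K with hk | hk
    · simpa using (hz k hk).1
    · simpa using coeff_eq_zero_of_natDegree_lt (lt_of_lt_of_le (Nat.lt_succ_of_le (le_max_left _ _)) hk)
  have hη : η = 0 := by
    ext k
    rcases lt_or_ge k K with hk | hk
    · simpa using (hz k hk).2
    · simpa using coeff_eq_zero_of_natDegree_lt (lt_of_lt_of_le (Nat.lt_succ_of_le (le_max_right _ _)) hk)
  rw [hξ, hη]
  rfl

end

/-! ### Polynomial combinations of the two generators and multiplication by the level -/

namespace System

/-- Multiplication of a function by the level. -/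
noncomputable def hmul (s : System) : (s.levels → ℝ) →ₗ[ℝ] (s.levels → ℝ) where
  toFun f := fun h => (h : ℝ) * f h
  map_add' f g := by ext h; simp [mul_add]
  map_smul' a f := by ext h; simp; ring

/-- The product of the first generator with the `k`-th power of the level. -/
noncomputable def gen₁ (s : System) (k : ℕ) : s.levels → ℝ := fun h => (h : ℝ) ^ k * s.mom 0 0 h

/-- The product of the second generator with the `k`-th power of the level. -/
noncomputable def gen₂ (s : System) (k : ℕ) : s.levels → ℝ := fun h => (h : ℝ) ^ k * s.mom s.d 0 h

/-- The space of combinations of the two generators whose coefficients have degree less than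
`a` and `b`. -/
noncomputable def T (s : System) (a b : ℕ) : Submodule ℝ (s.levels → ℝ) :=
  seqSpan s.gen₁ s.gen₂ a b

lemma seqMap_gen (s : System) (α β : ℝ[X]) (h : s.levels) :
    seqMap s.gen₁ s.gen₂ (α, β) h =
      α.eval (h : ℝ) * s.mom 0 0 h + β.eval (h : ℝ) * s.mom s.d 0 h := by
  rw [seqMap, LinearMap.coprod_apply, constr_monomials, constr_monomials, eval_eq_sum, eval_eq_sum]
  simp only [Polynomial.sum, Pi.add_apply, Finset.sum_apply, Pi.smul_apply, gen₁, gen₂,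
    smul_eq_mul, Finset.sum_mul, mul_assoc]

lemma seqMap_gen_injective (s : System) : Function.Injective (seqMap s.gen₁ s.gen₂) := by
  rw [← LinearMap.ker_eq_bot, LinearMap.ker_eq_bot']
  rintro ⟨α, β⟩ h0
  obtain ⟨h1, h2⟩ := s.eq_zero_of_relation (α := α) (β := β) fun h hh => by
    rw [← s.seqMap_gen α β ⟨h, hh⟩, h0]
    rfl
  rw [h1, h2]
  rfl

/-- Counterclockwise orientation makes `I₁` and `I₂` the negatives of the moments. -/
lemma comb_eq (s : System) (α β : ℝ[X]) : s.comb α β = seqMap s.gen₁ s.gen₂ (-α, -β) := by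
  funext h
  rw [s.seqMap_gen, comb, I₁_eq h.2, I₂_eq h.2]
  simp

lemma combs_eq (s : System) (a b : ℕ) : s.combs a b = s.T (a + 1) (b + 1) := by
  have hdeg : ∀ {p : ℝ[X]} {n : ℕ}, p ∈ degreeLT ℝ (n + 1) ↔ p.natDegree ≤ n := fun {p n} => by
    rw [mem_degreeLT, degree_lt_iff_coeff_zero, natDegree_le_iff_coeff_eq_zero]
    rfl
  ext I
  rw [T, seqSpan_eq_map]
  constructor
  · rintro ⟨α, β, hα, hβ, rfl⟩
    exact ⟨(-α, -β), ⟨neg_mem (hdeg.2 hα), neg_mem (hdeg.2 hβ)⟩, (s.comb_eq α β).symm⟩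
  · rintro ⟨⟨α, β⟩, ⟨hα, hβ⟩, rfl⟩
    exact ⟨-α, -β, hdeg.1 (neg_mem hα), hdeg.1 (neg_mem hβ), by rw [comb_eq, neg_neg, neg_neg]⟩

lemma gen₁_zero (s : System) : s.gen₁ 0 = s.M 0 0 := by ext h; simp [gen₁, M]

lemma gen₂_zero (s : System) : s.gen₂ 0 = s.M s.d 0 := by ext h; simp [gen₂, M]

lemma hmul_gen₁ (s : System) (k : ℕ) : s.hmul (s.gen₁ k) = s.gen₁ (k + 1) := by
  ext h; simp [hmul, gen₁, pow_succ]; ring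

lemma hmul_gen₂ (s : System) (k : ℕ) : s.hmul (s.gen₂ k) = s.gen₂ (k + 1) := by
  ext h; simp [hmul, gen₂, pow_succ]; ring

lemma hmul_mem_T {s : System} {a b : ℕ} {f : s.levels → ℝ} (hf : f ∈ s.T a b) :
    s.hmul f ∈ s.T (a + 1) (b + 1) := by
  have : s.T a b ≤ (s.T (a + 1) (b + 1)).comap s.hmul :=
    seqSpan_le (fun k hk => by
        rw [Submodule.mem_comap, hmul_gen₁]; exact mem_seqSpan_left (by omega))
      fun k hk => by
        rw [Submodule.mem_comap, hmul_gen₂]; exact mem_seqSpan_right (by omega)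
  exact this hf

lemma T_mono (s : System) {a b a' b' : ℕ} (ha : a ≤ a') (hb : b ≤ b') : s.T a b ≤ s.T a' b' :=
  seqSpan_mono ha hb

lemma M_zero_mem_T (s : System) {a b : ℕ} (ha : 0 < a) : s.M 0 0 ∈ s.T a b := by
  rw [← gen₁_zero]; exact mem_seqSpan_left ha

lemma M_d_mem_T (s : System) {a b : ℕ} (hb : 0 < b) : s.M s.d 0 ∈ s.T a b := by
  rw [← gen₂_zero]; exact mem_seqSpan_right hb

lemma finrank_T (s : System) (a b : ℕ) : Module.finrank ℝ (s.T a b) = a + b :=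
  finrank_seqSpan s.seqMap_gen_injective a b

/-- If multiplication by the level raises the degree of the moments by at most `e`, then the moments
contain the expected combinations of the generators. -/
lemma T_le_W {s : System} {e : ℕ} (hM : ∀ i j, s.hmul (s.M i j) ∈ s.W (i + j + 1 + e))
    {a b n : ℕ} (ha : ∀ k < a, k * e < n) (hb : ∀ k < b, k * e + s.d < n) : s.T a b ≤ s.W n := by
  have hW : ∀ {n f}, f ∈ s.W n → s.hmul f ∈ s.W (n + e) := fun {n f} hf => by
    have : s.W n ≤ (s.W (n + e)).comap s.hmul := W_le fun i j hij =>
      s.W_mono (by omega) (hM i j)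
    exact this hf
  have h1 : ∀ k, s.gen₁ k ∈ s.W (k * e + 1) := fun k => by
    induction k with
    | zero => rw [gen₁_zero]; exact s.M_mem_W (by omega)
    | succ k ih =>
      rw [← hmul_gen₁]
      exact s.W_mono (by rw [add_mul]; omega) (hW ih)
  have h2 : ∀ k, s.gen₂ k ∈ s.W (k * e + s.d + 1) := fun k => by
    induction k with
    | zero => rw [gen₂_zero]; exact s.M_mem_W (by omega)
    | succ k ih =>
      rw [← hmul_gen₂]
      exact s.W_mono (by rw [add_mul]; omega) (hW ih)
  exact seqSpan_le (fun k hk => s.W_mono (ha k hk) (h1 k)) fun k hk => s.W_mono (hb k hk) (h2 k)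

section
variable {s : System} {h : ℝ} (hh : h ∈ s.levels)
include hh

/-- The x-derivative of (H − h) x^(i+1) y^j integrates to zero over the domain; the shift in i
removes the truncated subtraction. -/
lemma momX (i j : ℕ) : h * ((i + 1) * s.mom i j h) =
    ∑ k, s.coef k * ((s.expX k + i + 1) * s.mom (i + s.expX k) (j + s.expY k) h) := by
  have := relY hh (i + 1) j
  simp only [← add_assoc, Nat.add_sub_cancel] at this
  push_cast at this
  simp only [this, add_comm i, add_comm j]

lemma momY (i j : ℕ) : h * ((j + 1) * s.mom i j h) =
    ∑ k, s.coef k * ((s.expY k + j + 1) * s.mom (i + s.expX k) (j + s.expY k) h) := by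
  have := relX hh i (j + 1)
  simp only [← add_assoc, Nat.add_sub_cancel] at this
  push_cast at this
  simp only [this, add_comm i, add_comm j]

end

lemma M_odd_right (s : System) (i : ℕ) {j : ℕ} (hj : Odd j) : s.M i j = 0 :=
  funext fun h => s.mom_odd_right i hj h

lemma M_odd_left {s : System} (he : s.e = 2) {i : ℕ} (hi : Odd i) (j : ℕ) : s.M i j = 0 :=
  funext fun h => mom_odd_left he hi j h

end System

end Ovals

/-! ### Reduction of the moments for the cubic Hamiltonians -/

namespace Ovals
namespace System

open Set Polynomial

lemma mem_of_smul_eq {E : Type*} [AddCommGroup E] [Module ℝ E] {S : Submodule ℝ E} {f g : E} {c : ℝ}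
    (hc : c ≠ 0) (h : c • f = g) (hg : g ∈ S) : f ∈ S :=
  (Submodule.smul_mem_iff S hc).1 (h ▸ hg)

/-- The moments lie in the expected spaces of combinations if every moment reduces to moments of
lower degree and to products of the level with moments whose degree is lower by `e`. -/
lemma W_le_T {s : System} {A B : ℕ → ℕ} {e : ℕ} (he : 0 < e) (hAm : Monotone A) (hBm : Monotone B)
    (hA : ∀ k, 1 ≤ k → A k + 1 ≤ A (k + e)) (hB : ∀ k, 1 ≤ k → B k + 1 ≤ B (k + e))
    (step : ∀ d, (∀ i j, i + j < d → s.M i j ∈ s.T (A (d + 1)) (B (d + 1))) →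
      (∀ i j, i + j + e ≤ d → s.hmul (s.M i j) ∈ s.T (A (d + 1)) (B (d + 1))) →
      ∀ i j, i + j = d → s.M i j ∈ s.T (A (d + 1)) (B (d + 1))) (n : ℕ) :
    s.W n ≤ s.T (A n) (B n) := by
  have key : ∀ d i j, i + j = d → s.M i j ∈ s.T (A (d + 1)) (B (d + 1)) := by
    intro d
    induction d using Nat.strong_induction_on with
    | _ d ih =>
      refine step d (fun i j hij => s.T_mono (hAm (by omega)) (hBm (by omega)) (ih _ hij i j rfl))
        fun i j hij => ?_
      refine s.T_mono ((hA (i + j + 1) (by omega)).trans (hAm (by omega)))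
        ((hB (i + j + 1) (by omega)).trans (hBm (by omega))) (hmul_mem_T (ih _ (by omega) i j rfl))
  exact W_le fun i j hij => s.T_mono (hAm (by omega)) (hBm (by omega)) (key _ i j rfl)

lemma cast_ne_zero_of_odd {k : ℤ} (hk : Odd k) : (k : ℝ) ≠ 0 := by
  have : k ≠ 0 := by rintro rfl; simp at hk
  exact_mod_cast this

section s1
variable {h : ℝ} (hh : h ∈ s1.levels)
include hh

lemma momX_s1 (i j : ℕ) : h * ((i + 1) * s1.mom i j h) = (i + 1) * s1.mom i (j + 2) h +
    (i + 3) * s1.mom (i + 2) j h - (i + 4) * s1.mom (i + 3) j h := by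
  have := momX hh i j
  simp only [coef, expX, expY, Fin.sum_univ_four, Matrix.cons_val, add_zero] at this
  push_cast at this
  linarith

lemma momY_s1 (i j : ℕ) : h * ((j + 1) * s1.mom i j h) = (j + 3) * s1.mom i (j + 2) h +
    (j + 1) * s1.mom (i + 2) j h - (j + 1) * s1.mom (i + 3) j h := by
  have := momY hh i j
  simp only [coef, expX, expY, Fin.sum_univ_four, Matrix.cons_val, add_zero] at this
  push_cast at this
  linarith

/-- This is ∬ y^j ∂H/∂x = 0, the case that the shifted relation `momX_s1` does not reach. -/
lemma mom_two_s1 (j : ℕ) : 3 * s1.mom 2 j h = 2 * s1.mom 1 j h := by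
  have := relY hh 0 j
  simp only [coef, expX, expY, Fin.sum_univ_four, Matrix.cons_val, add_zero] at this
  norm_num at this
  linarith

end s1

/-- Eliminating h lowers the degree of every moment with x-exponent at least 2. Eliminating instead
the moment of x^(i+3) y^j trades y² for a factor h, which disposes of y^j and x y^j. The second
elimination also shows that h costs only two degrees. -/
lemma W_s1 (n : ℕ) : s1.W n = s1.T ((n + 1) / 2) (n / 2) := by
  apply le_antisymm
  · refine W_le_T (A := fun n => (n + 1) / 2) (B := fun n => n / 2) (e := 2) (by norm_num)
      (fun a b h => by simp only; omega) (fun a b h => by simp only; omega)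
      (fun k _ => by omega) (fun k _ => by omega) ?_ n
    intro d hlow hlev
    have h2 : ∀ i j, i + 2 + j = d → s1.M (i + 2) j ∈ s1.T ((d + 1 + 1) / 2) ((d + 1) / 2) := by
      intro i j hij
      rcases i with _ | i
      · refine mem_of_smul_eq (c := 3) (g := (2 : ℝ) • s1.M 1 j) (by norm_num) ?_
          (Submodule.smul_mem _ _ (hlow _ _ (by omega)))
        funext h
        exact mom_two_s1 h.2 j
      · refine mem_of_smul_eq (c := 3 * (j + 1)) (g := (2 * (j + 1) : ℝ) • s1.M (i + 2) j -
          (2 * (i + 1) : ℝ) • s1.M i (j + 2)) (by positivity) ?_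
          (sub_mem (Submodule.smul_mem _ _ (hlow _ _ (by omega)))
            (Submodule.smul_mem _ _ (hlow _ _ (by omega))))
        funext h
        simp only [Pi.smul_apply, Pi.sub_apply, smul_eq_mul, M]
        linear_combination (j + 1 : ℝ) * momX_s1 h.2 i j - (i + 1 : ℝ) * momY_s1 h.2 i j
    intro i j hij
    rcases i with _ | _ | i
    rotate_left 2
    · exact h2 i j hij
    all_goals rcases j with _ | _ | j
    · exact s1.M_zero_mem_T (by omega)
    · rw [M_odd_right _ _ (j := 0 + 1) odd_one]; exact zero_mem _
    rotate_left
    · exact s1.M_d_mem_T (by omega)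
    · rw [M_odd_right _ _ (j := 0 + 1) odd_one]; exact zero_mem _
    · refine mem_of_smul_eq (c := 3 * j + 13) (g := (3 * (j + 1) : ℝ) • s1.hmul (s1.M 1 j) -
        (j + 1 : ℝ) • s1.M 3 j) (by positivity) ?_
        (sub_mem (Submodule.smul_mem _ _ (hlev _ _ (by omega)))
          (Submodule.smul_mem _ _ (h2 1 j (by omega))))
      funext h
      have hX := momX_s1 h.2 1 j
      have hY := momY_s1 h.2 1 j
      simp only [Pi.smul_apply, Pi.sub_apply, smul_eq_mul, M, hmul, LinearMap.coe_mk,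
        AddHom.coe_mk]
      push_cast at hX hY
      linear_combination (j + 1 : ℝ) * hX - (5 : ℝ) * hY
    · refine mem_of_smul_eq (c := 3 * j + 11) (g := (3 * (j + 1) : ℝ) • s1.hmul (s1.M 0 j) -
        (j + 1 : ℝ) • s1.M 2 j) (by positivity) ?_
        (sub_mem (Submodule.smul_mem _ _ (hlev _ _ (by omega)))
          (Submodule.smul_mem _ _ (h2 0 j (by omega))))
      funext h
      have hX := momX_s1 h.2 0 j
      have hY := momY_s1 h.2 0 j
      simp only [Pi.smul_apply, Pi.sub_apply, smul_eq_mul, M, hmul, LinearMap.coe_mk,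
        AddHom.coe_mk]
      push_cast at hX hY
      linear_combination (j + 1 : ℝ) * hX - (4 : ℝ) * hY
  · refine T_le_W (e := 2) (fun i j => ?_) (fun k hk => by omega) (fun k hk => by
      simp only [d]; omega)
    refine mem_of_smul_eq (c := 3 * (j + 1)) (g := (2 * i + 3 * j + 11 : ℝ) • s1.M i (j + 2) +
        (j + 1 : ℝ) • s1.M (i + 2) j) (by positivity) ?_
        (add_mem (Submodule.smul_mem _ _ (s1.M_mem_W (by omega)))
          (Submodule.smul_mem _ _ (s1.M_mem_W (by omega))))
    funext h
    simp only [Pi.smul_apply, Pi.add_apply, smul_eq_mul, M, hmul, LinearMap.coe_mk,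
        AddHom.coe_mk]
    linear_combination (i + 4 : ℝ) * momY_s1 h.2 i j - (j + 1 : ℝ) * momX_s1 h.2 i j

section s2
variable {h : ℝ} (hh : h ∈ s2.levels)
include hh

lemma momX_s2 (i j : ℕ) : h * ((i + 1) * s2.mom i j h) = (i + 1) * s2.mom i (j + 2) h +
    (i + 3) * s2.mom (i + 2) j h - (i + 2) * s2.mom (i + 1) (j + 2) h := by
  have := momX hh i j
  simp only [coef, expX, expY, Fin.sum_univ_four, Matrix.cons_val, add_zero] at this
  push_cast at this
  linarith

lemma momY_s2 (i j : ℕ) : h * ((j + 1) * s2.mom i j h) = (j + 3) * s2.mom i (j + 2) h +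
    (j + 1) * s2.mom (i + 2) j h - (j + 3) * s2.mom (i + 1) (j + 2) h := by
  have := momY hh i j
  simp only [coef, expX, expY, Fin.sum_univ_four, Matrix.cons_val, add_zero] at this
  push_cast at this
  linarith

lemma mom_zero_s2 (j : ℕ) : s2.mom 0 (j + 2) h = 2 * s2.mom 1 j h := by
  have := relY hh 0 j
  simp only [coef, expX, expY, Fin.sum_univ_four, Matrix.cons_val, add_zero] at this
  norm_num at this
  rw [add_comm j 2]
  linarith

end s2

/-- As for `s1`, but here the cubic monomial is x y², so eliminating h lowers moments with
y-exponent at least 2, and powers of x are reduced by a factor h. -/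
lemma W_s2 (n : ℕ) : s2.W n = s2.T ((n + 1) / 2) (n / 2) := by
  apply le_antisymm
  · refine W_le_T (A := fun n => (n + 1) / 2) (B := fun n => n / 2) (e := 2) (by norm_num)
      (fun a b h => by simp only; omega) (fun a b h => by simp only; omega)
      (fun k _ => by omega) (fun k _ => by omega) ?_ n
    intro d hlow hlev
    have h2 : ∀ i j, i + (j + 2) = d → s2.M i (j + 2) ∈ s2.T ((d + 1 + 1) / 2) ((d + 1) / 2) := by
      intro i j hij
      rcases Nat.even_or_odd j with hj | hj
      · rcases i with _ | i
        · have : s2.M 0 (j + 2) = (2 : ℝ) • s2.M 1 j := funext fun h => mom_zero_s2 h.2 j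
          rw [this]
          exact Submodule.smul_mem _ _ (hlow _ _ (by omega))
        · have hc := cast_ne_zero_of_odd (k := 2 * i + 1 - j) (by
            obtain ⟨m, rfl⟩ := hj; exact ⟨i - m, by push_cast; ring⟩)
          push_cast at hc
          refine mem_of_smul_eq hc (g := (2 * (i + 1) : ℝ) • s2.M i (j + 2) -
            (2 * (j + 1) : ℝ) • s2.M (i + 2) j) ?_
            (sub_mem (Submodule.smul_mem _ _ (hlow _ _ (by omega)))
              (Submodule.smul_mem _ _ (hlow _ _ (by omega))))
          funext h
          simp only [Pi.smul_apply, Pi.sub_apply, smul_eq_mul, M]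
          linear_combination (i + 1 : ℝ) * momY_s2 h.2 i j - (j + 1 : ℝ) * momX_s2 h.2 i j
      · rw [M_odd_right _ _ (hj.add_even even_two)]; exact zero_mem _
    intro i j hij
    rcases j with _ | _ | j
    · rcases i with _ | _ | i
      · exact s2.M_zero_mem_T (by omega)
      · exact s2.M_d_mem_T (by omega)
      · refine mem_of_smul_eq (c := (i + 3) * (2 * i + 1) + 2 * (i + 2))
          (g := ((2 * i + 1) * (i + 1) : ℝ) • s2.hmul (s2.M i 0) + (3 * (i + 1) : ℝ) • s2.M i 2)
          (by positivity) ?_ (add_mem (Submodule.smul_mem _ _ (hlev _ _ (by omega)))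
            (Submodule.smul_mem _ _ (h2 i 0 (by omega))))
        funext h
        have hX := momX_s2 h.2 i 0
        have hY := momY_s2 h.2 i 0
        simp only [Pi.smul_apply, Pi.add_apply, smul_eq_mul, M, hmul, LinearMap.coe_mk,
          AddHom.coe_mk]
        simp only [zero_add, Nat.cast_zero] at hX hY
        linear_combination -(2 * i + 1 : ℝ) * hX - (i + 2 : ℝ) * (hX - (i + 1) * hY)
    · rw [M_odd_right _ _ (j := 0 + 1) odd_one]; exact zero_mem _
    · exact h2 i j hij
  · refine T_le_W (e := 2) (fun i j => ?_) (fun k hk => by omega) (fun k hk => by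
      simp only [d]; omega)
    rcases Nat.even_or_odd j with hj | hj
    · have hc := cast_ne_zero_of_odd (k := 2 * i + 1 - j) (by
        obtain ⟨m, rfl⟩ := hj; exact ⟨i - m, by push_cast; ring⟩)
      push_cast at hc
      refine mem_of_smul_eq hc (g := (-(j + 3) : ℝ) • s2.M i (j + 2) +
        ((i + 3) * (j + 3) - (i + 2) * (j + 1) : ℝ) • s2.M (i + 2) j) ?_
        (add_mem (Submodule.smul_mem _ _ (s2.M_mem_W (by omega)))
          (Submodule.smul_mem _ _ (s2.M_mem_W (by omega))))
      funext h
      simp only [Pi.smul_apply, Pi.add_apply, smul_eq_mul, M, hmul, LinearMap.coe_mk,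
        AddHom.coe_mk]
      linear_combination (j + 3 : ℝ) * momX_s2 h.2 i j - (i + 2 : ℝ) * momY_s2 h.2 i j
    · rw [M_odd_right _ _ hj, map_zero]; exact zero_mem _

section s3
variable {h : ℝ} (hh : h ∈ s3.levels)
include hh

lemma momX_s3 (i j : ℕ) : h * ((i + 1) * s3.mom i j h) = (i + 1) / 2 * s3.mom i (j + 2) h +
    (i + 3) / 2 * s3.mom (i + 2) j h - (i + 4) / 3 * s3.mom (i + 3) j h +
    (i + 2) * s3.mom (i + 1) (j + 2) h := by
  have := momX hh i j
  simp only [coef, expX, expY, Fin.sum_univ_four, Matrix.cons_val, add_zero] at this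
  push_cast at this
  linarith

lemma momY_s3 (i j : ℕ) : h * ((j + 1) * s3.mom i j h) = (j + 3) / 2 * s3.mom i (j + 2) h +
    (j + 1) / 2 * s3.mom (i + 2) j h - (j + 1) / 3 * s3.mom (i + 3) j h +
    (j + 3) * s3.mom (i + 1) (j + 2) h := by
  have := momY hh i j
  simp only [coef, expX, expY, Fin.sum_univ_four, Matrix.cons_val, add_zero] at this
  push_cast at this
  linarith

lemma mom_zero_s3 (j : ℕ) : s3.mom 0 (j + 2) h = s3.mom 2 j h - s3.mom 1 j h := by
  have := relY hh 0 j
  simp only [coef, expX, expY, Fin.sum_univ_four, Matrix.cons_val, add_zero] at this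
  norm_num at this
  rw [add_comm j 2]
  linarith

end s3

/-- The two relations are solved for both moments of degree i + j + 3, with determinant proportional
to 2i + 2j + 10. A factor h thus replaces three degrees, and only the moments 1 and x² survive
because that of x vanishes. -/
lemma W_s3 (n : ℕ) : s3.W n = s3.T ((n + 2) / 3) (n / 3) := by
  apply le_antisymm
  · refine W_le_T (A := fun n => (n + 2) / 3) (B := fun n => n / 3) (e := 3) (by norm_num)
      (fun a b h => by simp only; omega) (fun a b h => by simp only; omega)
      (fun k _ => by omega) (fun k _ => by omega) ?_ n
    intro d hlow hlev
    have h3 : ∀ i j, i + 3 + j = d → s3.M (i + 3) j ∈ s3.T ((d + 1 + 2) / 3) ((d + 1) / 3) := by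
      intro i j hij
      refine mem_of_smul_eq (c := (2 * i + 2 * j + 10) / 3)
        (g := (((i + 1) * (j + 3) - (i + 2) * (j + 3)) / 2 : ℝ) • s3.M i (j + 2) +
          (((i + 3) * (j + 3) - (i + 2) * (j + 1)) / 2 : ℝ) • s3.M (i + 2) j -
          ((i + 1) * (j + 3) - (i + 2) * (j + 1) : ℝ) • s3.hmul (s3.M i j)) (by positivity) ?_
        (sub_mem (add_mem (Submodule.smul_mem _ _ (hlow _ _ (by omega)))
          (Submodule.smul_mem _ _ (hlow _ _ (by omega))))
          (Submodule.smul_mem _ _ (hlev _ _ (by omega))))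
      funext h
      simp only [Pi.smul_apply, Pi.add_apply, Pi.sub_apply, smul_eq_mul, M, hmul,
        LinearMap.coe_mk, AddHom.coe_mk]
      linear_combination (j + 3 : ℝ) * momX_s3 h.2 i j - (i + 2 : ℝ) * momY_s3 h.2 i j
    have h1 : ∀ i j, i + 1 + (j + 2) = d →
        s3.M (i + 1) (j + 2) ∈ s3.T ((d + 1 + 2) / 3) ((d + 1) / 3) := by
      intro i j hij
      refine mem_of_smul_eq (c := 2 * i + 2 * j + 10)
        (g := (((i + 1) * (j + 1) - (i + 4) * (j + 3)) / 2 : ℝ) • s3.M i (j + 2) +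
          (((i + 3) * (j + 1) - (i + 4) * (j + 1)) / 2 : ℝ) • s3.M (i + 2) j -
          ((i + 1) * (j + 1) - (i + 4) * (j + 1) : ℝ) • s3.hmul (s3.M i j)) (by positivity) ?_
        (sub_mem (add_mem (Submodule.smul_mem _ _ (hlow _ _ (by omega)))
          (Submodule.smul_mem _ _ (hlow _ _ (by omega))))
          (Submodule.smul_mem _ _ (hlev _ _ (by omega))))
      funext h
      simp only [Pi.smul_apply, Pi.add_apply, Pi.sub_apply, smul_eq_mul, M, hmul,
        LinearMap.coe_mk, AddHom.coe_mk]
      linear_combination (j + 1 : ℝ) * momX_s3 h.2 i j - (i + 4 : ℝ) * momY_s3 h.2 i j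
    have h20 : 2 ≤ d → s3.M 2 0 ∈ s3.T ((d + 1 + 2) / 3) ((d + 1) / 3) := fun hd =>
      s3.M_d_mem_T (by omega)
    intro i j hij
    rcases Nat.even_or_odd j with hj | hj
    · rcases j with _ | _ | j
      · rcases i with _ | _ | _ | i
        · exact s3.M_zero_mem_T (by omega)
        · have : s3.M 1 0 = 0 := funext fun h => mom_one_zero_s3 h.2
          rw [this]; exact zero_mem _
        · exact h20 (by omega)
        · exact h3 i 0 hij
      · exact absurd hj (by decide)
      · rcases i with _ | i
        · have h0 : s3.M 0 (j + 2) = s3.M 2 j - s3.M 1 j := funext fun h => mom_zero_s3 h.2 j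
          rw [h0]
          refine sub_mem ?_ (hlow _ _ (by omega))
          rcases j with _ | _ | j
          · exact h20 (by omega)
          · exact absurd hj (by decide)
          · exact h1 1 j (by omega)
        · exact h1 i j hij
    · rw [M_odd_right _ _ hj]; exact zero_mem _
  · refine T_le_W (e := 3) (fun i j => ?_) (fun k hk => by omega) (fun k hk => by
      simp only [d]; omega)
    refine mem_of_smul_eq (c := i + 1) (g := ((i + 1) / 2 : ℝ) • s3.M i (j + 2) +
      ((i + 3) / 2 : ℝ) • s3.M (i + 2) j - ((i + 4) / 3 : ℝ) • s3.M (i + 3) j +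
      (i + 2 : ℝ) • s3.M (i + 1) (j + 2)) (by positivity) ?_
      (add_mem (sub_mem (add_mem (Submodule.smul_mem _ _ (s3.M_mem_W (by omega)))
        (Submodule.smul_mem _ _ (s3.M_mem_W (by omega))))
        (Submodule.smul_mem _ _ (s3.M_mem_W (by omega))))
        (Submodule.smul_mem _ _ (s3.M_mem_W (by omega))))
    funext h
    simp only [Pi.smul_apply, Pi.add_apply, Pi.sub_apply, smul_eq_mul, M, hmul,
      LinearMap.coe_mk, AddHom.coe_mk]
    linear_combination momX_s3 h.2 i j

end System
end Ovals

/-! ### Reduction of the moments for the quartic Hamiltonians with H − y² depending on x alone -/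

namespace Ovals
namespace System

open Set Polynomial

section s4_s5
variable {s : System} {ε : ℝ} (hs : s = .s4 ∧ ε = 1 ∨ s = .s5 ∧ ε = -1)
include hs

lemma momX_s4_s5 {h : ℝ} (hh : h ∈ s.levels) (i j : ℕ) : h * ((i + 1) * s.mom i j h) =
    (i + 1) * s.mom i (j + 2) h + (i + 3) * s.mom (i + 2) j h +
      ε * ((i + 5) * s.mom (i + 4) j h) := by
  have := momX hh i j
  rcases hs with ⟨rfl, rfl⟩ | ⟨rfl, rfl⟩ <;>
  · simp only [coef, expX, expY, Fin.sum_univ_four, Matrix.cons_val, add_zero] at this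
    push_cast at this
    linarith

lemma momY_s4_s5 {h : ℝ} (hh : h ∈ s.levels) (i j : ℕ) : h * ((j + 1) * s.mom i j h) =
    (j + 3) * s.mom i (j + 2) h + (j + 1) * s.mom (i + 2) j h +
      ε * ((j + 1) * s.mom (i + 4) j h) := by
  have := momY hh i j
  rcases hs with ⟨rfl, rfl⟩ | ⟨rfl, rfl⟩ <;>
  · simp only [coef, expX, expY, Fin.sum_univ_four, Matrix.cons_val, add_zero] at this
    push_cast at this
    linarith

/-- Eliminating h lowers every x-exponent of at least 4. Eliminating the moment of x^(i+4) y^j gives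
`hred`, which trades y² for h or x². Odd moments vanish, so 1 and x² generate. -/
lemma W_s4_s5 (n : ℕ) : s.W n = s.T ((n + 1) / 2) ((n - 1) / 2) := by
  have he : s.e = 2 := by rcases hs with ⟨rfl, rfl⟩ | ⟨rfl, rfl⟩ <;> rfl
  have hd2 : s.d = 2 := by rcases hs with ⟨rfl, rfl⟩ | ⟨rfl, rfl⟩ <;> rfl
  have hε : ε ≠ 0 := by rcases hs with ⟨_, rfl⟩ | ⟨_, rfl⟩ <;> norm_num
  have hred : ∀ i j : ℕ, (i + 2 * j + 7 : ℝ) • s.M i (j + 2) =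
      (2 * (j + 1) : ℝ) • s.hmul (s.M i j) - (j + 1 : ℝ) • s.M (i + 2) j := fun i j => by
    funext h
    simp only [Pi.smul_apply, Pi.sub_apply, smul_eq_mul, M, hmul, LinearMap.coe_mk, AddHom.coe_mk]
    linear_combination (j + 1 : ℝ) / 2 * momX_s4_s5 hs h.2 i j -
      (i + 5 : ℝ) / 2 * momY_s4_s5 hs h.2 i j
  apply le_antisymm
  · refine W_le_T (A := fun n => (n + 1) / 2) (B := fun n => (n - 1) / 2) (e := 2) (by norm_num)
      (fun a b h => by simp only; omega) (fun a b h => by simp only; omega)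
      (fun k _ => by omega) (fun k _ => by omega) ?_ n
    intro d hlow hlev
    have h4 : ∀ i j, i + 4 + j = d →
        s.M (i + 4) j ∈ s.T ((d + 1 + 1) / 2) ((d + 1 - 1) / 2) := by
      intro i j hij
      refine mem_of_smul_eq (c := ε * (2 * (j + 1))) (g := (i + 1 : ℝ) • s.M i (j + 2) -
        (j + 1 : ℝ) • s.M (i + 2) j) (mul_ne_zero hε (by positivity)) ?_
        (sub_mem (Submodule.smul_mem _ _ (hlow _ _ (by omega)))
          (Submodule.smul_mem _ _ (hlow _ _ (by omega))))
      funext h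
      simp only [Pi.smul_apply, Pi.sub_apply, smul_eq_mul, M]
      linear_combination (i + 1 : ℝ) / 2 * momY_s4_s5 hs h.2 i j -
        (j + 1 : ℝ) / 2 * momX_s4_s5 hs h.2 i j
    have h2 : ∀ j, 2 + (j + 2) = d →
        s.M 2 (j + 2) ∈ s.T ((d + 1 + 1) / 2) ((d + 1 - 1) / 2) := fun j hj =>
      mem_of_smul_eq (by positivity) (hred 2 j)
        (sub_mem (Submodule.smul_mem _ _ (hlev _ _ (by omega)))
          (Submodule.smul_mem _ _ (h4 0 j (by omega))))
    have h20 : 2 ≤ d → s.M 2 0 ∈ s.T ((d + 1 + 1) / 2) ((d + 1 - 1) / 2) := fun hd => by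
      have := s.M_d_mem_T (a := (d + 1 + 1) / 2) (b := (d + 1 - 1) / 2) (by omega)
      rwa [hd2] at this
    intro i j hij
    rcases Nat.even_or_odd i with hi | hi
    rotate_left
    · rw [M_odd_left he hi]; exact zero_mem _
    rcases Nat.even_or_odd j with hj | hj
    rotate_left
    · rw [M_odd_right _ _ hj]; exact zero_mem _
    rcases i with _ | _ | _ | _ | i
    · rcases j with _ | _ | j
      · exact s.M_zero_mem_T (by omega)
      · exact absurd hj (by decide)
      · refine mem_of_smul_eq (by positivity) (hred 0 j)
          (sub_mem (Submodule.smul_mem _ _ (hlev _ _ (by omega))) (Submodule.smul_mem _ _ ?_))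
        rcases j with _ | _ | j
        · exact h20 (by omega)
        · exact absurd hj (by decide)
        · exact h2 j (by omega)
    · exact absurd hi (by decide)
    · rcases j with _ | _ | j
      · exact h20 (by omega)
      · exact absurd hj (by decide)
      · exact h2 j (by omega)
    · exact absurd hi (by decide)
    · exact h4 i j hij
  · refine T_le_W (e := 2) (fun i j => ?_) (fun k hk => by omega) (fun k hk => by omega)
    refine mem_of_smul_eq (c := 2 * (j + 1)) (g := (i + 2 * j + 7 : ℝ) • s.M i (j + 2) +
      (j + 1 : ℝ) • s.M (i + 2) j) (by positivity) (by rw [hred]; abel)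
      (add_mem (Submodule.smul_mem _ _ (s.M_mem_W (by omega)))
        (Submodule.smul_mem _ _ (s.M_mem_W (by omega))))

end s4_s5

/-! ### Diagonal and axis moments for the Hamiltonians symmetric in x and y -/

section s6_s7
variable {s : System} {ε : ℝ} (hs : s = .s6 ∧ ε = 1 ∨ s = .s7 ∧ ε = -1)
include hs

lemma momX_s6_s7 {h : ℝ} (hh : h ∈ s.levels) (i j : ℕ) : h * ((i + 1) * s.mom i j h) =
    (i + 1) * s.mom i (j + 2) h + (i + 3) * s.mom (i + 2) j h +
      ε * ((i + 3) * s.mom (i + 2) (j + 2) h) := by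
  have := momX hh i j
  rcases hs with ⟨rfl, rfl⟩ | ⟨rfl, rfl⟩ <;>
  · simp only [coef, expX, expY, Fin.sum_univ_four, Matrix.cons_val, add_zero] at this
    push_cast at this
    linarith

lemma momY_s6_s7 {h : ℝ} (hh : h ∈ s.levels) (i j : ℕ) : h * ((j + 1) * s.mom i j h) =
    (j + 3) * s.mom i (j + 2) h + (j + 1) * s.mom (i + 2) j h +
      ε * ((j + 3) * s.mom (i + 2) (j + 2) h) := by
  have := momY hh i j
  rcases hs with ⟨rfl, rfl⟩ | ⟨rfl, rfl⟩ <;>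
  · simp only [coef, expX, expY, Fin.sum_univ_four, Matrix.cons_val, add_zero] at this
    push_cast at this
    linarith

lemma M_swap (i j : ℕ) : s.M i j = s.M j i :=
  funext fun h => mom_swap (by rcases hs with ⟨rfl, _⟩ | ⟨rfl, _⟩ <;> simp) i j h

/-- The reduction of the mixed moments. -/
lemma M_mixed_s6_s7 (i j : ℕ) : (ε * (i - j)) • s.M (i + 2) (j + 2) =
    (j + 1 : ℝ) • s.M (i + 2) j - (i + 1 : ℝ) • s.M i (j + 2) := by
  funext h
  simp only [Pi.smul_apply, Pi.sub_apply, smul_eq_mul, M]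
  linear_combination (j + 1 : ℝ) / 2 * momX_s6_s7 hs h.2 i j -
    (i + 1 : ℝ) / 2 * momY_s6_s7 hs h.2 i j

lemma ε_mul_sub_ne_zero {i j : ℕ} (hij : i ≠ j) : ε * (i - j : ℝ) ≠ 0 := by
  refine mul_ne_zero (by rcases hs with ⟨_, rfl⟩ | ⟨_, rfl⟩ <;> norm_num) (sub_ne_zero.2 ?_)
  exact_mod_cast hij

/-- The reduction of mixed moments carries the factor i − j, so it fails exactly on the diagonal. Up
to the swap of x and y, the diagonal and the axis moments remain. -/
lemma W_s6_s7 {n : ℕ} (hn : 1 ≤ n) : s.W n =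
    seqSpan (fun k => s.M (2 * k) (2 * k)) (fun k => s.M (2 * k + 2) 0) ((n - 1) / 4 + 1)
      ((n - 1) / 2) := by
  have he : s.e = 2 := by rcases hs with ⟨rfl, rfl⟩ | ⟨rfl, rfl⟩ <;> rfl
  apply le_antisymm
  · have key : ∀ d i j, i + j = d → s.M i j ∈ seqSpan (fun k => s.M (2 * k) (2 * k))
        (fun k => s.M (2 * k + 2) 0) (d / 4 + 1) (d / 2) := by
      intro d
      induction d using Nat.strong_induction_on with
      | _ d ih =>
        intro i j hij
        have hlow : ∀ i j, i + j < d → s.M i j ∈ seqSpan (fun k => s.M (2 * k) (2 * k))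
            (fun k => s.M (2 * k + 2) 0) (d / 4 + 1) (d / 2) := fun i j h =>
          seqSpan_mono (by omega) (by omega) (ih _ h i j rfl)
        have haxis : ∀ i, i + 2 = d → Even i → s.M (i + 2) 0 ∈
            seqSpan (fun k => s.M (2 * k) (2 * k)) (fun k => s.M (2 * k + 2) 0)
              (d / 4 + 1) (d / 2) := fun i h hi => by
          obtain ⟨k, rfl⟩ := hi
          rw [← two_mul]
          exact mem_seqSpan_right (v := fun k => s.M (2 * k + 2) 0) (by omega)
        rcases Nat.even_or_odd i with hi | hi
        rotate_left
        · rw [M_odd_left he hi]; exact zero_mem _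
        rcases Nat.even_or_odd j with hj | hj
        rotate_left
        · rw [M_odd_right _ _ hj]; exact zero_mem _
        by_cases hne : i = j
        · subst hne
          obtain ⟨k, rfl⟩ := hi
          rw [← two_mul]
          exact mem_seqSpan_left (u := fun k => s.M (2 * k) (2 * k)) (by omega)
        rcases i with _ | _ | i
        · rcases j with _ | _ | j
          · exact absurd rfl hne
          · exact absurd hj (by decide)
          · rw [M_swap hs]
            exact haxis j (by omega) (by obtain ⟨m, hm⟩ := hj; exact ⟨m - 1, by omega⟩)
        · exact absurd hi (by decide)
        rcases j with _ | _ | j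
        · exact haxis i (by omega) (by obtain ⟨m, hm⟩ := hi; exact ⟨m - 1, by omega⟩)
        · exact absurd hj (by decide)
        · exact mem_of_smul_eq (ε_mul_sub_ne_zero hs (by omega)) (M_mixed_s6_s7 hs i j)
            (sub_mem (Submodule.smul_mem _ _ (hlow _ _ (by omega)))
              (Submodule.smul_mem _ _ (hlow _ _ (by omega))))
    exact W_le fun i j hij => seqSpan_mono (by omega) (by omega) (key _ i j rfl)
  · exact seqSpan_le (fun k hk => s.M_mem_W (by omega)) fun k hk => s.M_mem_W (by omega)

/-- The leading terms of the moments `M (2 k) (2 k)` and `M (2 k + 2) 0` with respect to the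
generators. -/
lemma lead_s6_s7 (k : ℕ) :
    (∃ c : ℝ, c ≠ 0 ∧ s.M (2 * k) (2 * k) - c • s.gen₁ k ∈ s.T k k) ∧
    (∃ c e : ℝ, e ≠ 0 ∧ (c = 0 ↔ k = 0) ∧
      s.M (2 * k + 2) 0 - (c • s.gen₁ k + e • s.gen₂ k) ∈ s.T k k) ∧
    ∀ j, j < k + 1 → s.M (2 * k + 2) (2 * j) ∈ s.T (k + 1) (k + 1) := by
  have hd2 : s.d = 2 := by rcases hs with ⟨rfl, rfl⟩ | ⟨rfl, rfl⟩ <;> rfl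
  have hε : ε ≠ 0 := by rcases hs with ⟨_, rfl⟩ | ⟨_, rfl⟩ <;> norm_num
  -- The claims support each other: the next diagonal and axis moments need the mixed moments of the
  -- previous stage, and the mixed moments need both.
  induction k with
  | zero =>
    refine ⟨⟨1, one_ne_zero, ?_⟩, ⟨0, 1, one_ne_zero, by simp, ?_⟩, fun j hj => ?_⟩
    · rw [gen₁_zero]; simp
    · rw [gen₂_zero, hd2]; simp
    · obtain rfl : j = 0 := by omega
      have := s.M_d_mem_T (a := 1) (b := 1) one_pos
      rwa [hd2] at this
  | succ k ih =>
    obtain ⟨⟨c, hc, hP⟩, ⟨c₁, e₁, he₁, hc₁, hQ⟩, hmix⟩ := ih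
    have hPh := hmul_mem_T hP
    have hQh := hmul_mem_T hQ
    simp only [map_sub, map_add, map_smul, hmul_gen₁, hmul_gen₂] at hPh hQh
    -- The relation at (2k, 2k), simplified by the swap symmetry, expresses the next diagonal moment
    -- through h times the last one and one mixed moment of lower order in h.
    have hdiag : ∃ c : ℝ, c ≠ 0 ∧
        s.M (2 * (k + 1)) (2 * (k + 1)) - c • s.gen₁ (k + 1) ∈ s.T (k + 1) (k + 1) := by
      have hk : (2 * k + 3 : ℝ) ≠ 0 := by positivity
      refine ⟨(2 * k + 1) * c / (ε * (2 * k + 3)), by positivity, ?_⟩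
      refine mem_of_smul_eq (c := ε * (2 * k + 3)) (g := (2 * k + 1 : ℝ) •
        (s.hmul (s.M (2 * k) (2 * k)) - c • s.gen₁ (k + 1)) -
        (4 * k + 4 : ℝ) • s.M (2 * k + 2) (2 * k)) (mul_ne_zero hε hk) ?_
        (sub_mem (Submodule.smul_mem _ _ hPh) (Submodule.smul_mem _ _ (hmix k (by omega))))
      funext h
      have hX := momX_s6_s7 hs h.2 (2 * k) (2 * k)
      have hsw := congrFun (M_swap hs (2 * k) (2 * k + 2)) h
      simp only [M] at hsw
      simp only [Pi.smul_apply, Pi.sub_apply, smul_eq_mul, M, hmul, LinearMap.coe_mk,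
        AddHom.coe_mk, mul_add, mul_one]
      rw [hsw] at hX
      push_cast at hX
      field_simp
      linear_combination -hX
    obtain ⟨c₂, hc₂, hP₂⟩ := hdiag
    have hP₂' : s.M (2 * (k + 1)) (2 * (k + 1)) ∈ s.T (k + 2) (k + 2) := by
      have h1 := s.T_mono (Nat.le_succ _) (Nat.le_succ _) hP₂
      have h2 : c₂ • s.gen₁ (k + 1) ∈ s.T (k + 2) (k + 2) :=
        Submodule.smul_mem _ _ (mem_seqSpan_left (by omega))
      simpa using add_mem h1 h2
    -- Both relations at (2k + 2, 0), with the moment of x^(2k+4) y² eliminated.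
    have haxis : (2 * k + 5 : ℝ) • s.M (2 * (k + 1) + 2) 0 =
        (2 * k + 2 : ℝ) • s.hmul (s.M (2 * k + 2) 0) + (3 : ℝ) • s.M (2 * k + 2) 2 := by
      funext h
      have hX := momX_s6_s7 hs h.2 (2 * k + 2) 0
      have hY := momY_s6_s7 hs h.2 (2 * k + 2) 0
      simp only [Pi.smul_apply, Pi.add_apply, smul_eq_mul, M, hmul, LinearMap.coe_mk,
        AddHom.coe_mk, mul_add, mul_one]
      push_cast at hX hY
      simp only [zero_add] at hX hY
      linear_combination (2 * k + 5 : ℝ) / 2 * hY - 3 / 2 * hX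
    have hk : (2 * k + 5 : ℝ) ≠ 0 := by positivity
    have hQ₂ : ∃ c e : ℝ, e ≠ 0 ∧ (c = 0 ↔ k + 1 = 0) ∧
        s.M (2 * (k + 1) + 2) 0 - (c • s.gen₁ (k + 1) + e • s.gen₂ (k + 1)) ∈
          s.T (k + 1) (k + 1) := by
      -- At k = 0 this moment is the diagonal (2, 2), which makes the first generator enter the axis
      -- moments. For k ≥ 1 it is of lower order and c₁ is already nonzero.
      have h22 : ∃ b : ℝ, (2 * k + 2) * c₁ + 3 * b ≠ 0 ∧
          s.M (2 * k + 2) 2 - b • s.gen₁ (k + 1) ∈ s.T (k + 1) (k + 1) := by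
        rcases Nat.eq_zero_or_pos k with rfl | hk0
        · refine ⟨c₂, ?_, hP₂⟩
          rw [hc₁.2 rfl, mul_zero, zero_add]
          positivity
        · refine ⟨0, ?_, ?_⟩
          · have := mt hc₁.1 hk0.ne'
            rw [mul_zero, add_zero]
            positivity
          · rw [zero_smul, sub_zero]
            exact hmix 1 (by omega)
      obtain ⟨b, hb, hM⟩ := h22
      refine ⟨((2 * k + 2) * c₁ + 3 * b) / (2 * k + 5), (2 * k + 2) * e₁ / (2 * k + 5),
        by positivity, iff_of_false (by positivity) (by omega), ?_⟩
      refine mem_of_smul_eq (c := 2 * k + 5) (g := (2 * k + 2 : ℝ) •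
        (s.hmul (s.M (2 * k + 2) 0) - (c₁ • s.gen₁ (k + 1) + e₁ • s.gen₂ (k + 1))) +
        (3 : ℝ) • (s.M (2 * k + 2) 2 - b • s.gen₁ (k + 1))) hk ?_
        (add_mem (Submodule.smul_mem _ _ hQh) (Submodule.smul_mem _ _ hM))
      rw [smul_sub, haxis, smul_add, smul_smul, smul_smul, mul_div_cancel₀ _ hk,
        mul_div_cancel₀ _ hk]
      module
    refine ⟨⟨c₂, hc₂, hP₂⟩, hQ₂, fun j hj => ?_⟩
    induction j with
    | zero =>
      obtain ⟨c₃, e₃, _, _, h3⟩ := hQ₂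
      have h1 := s.T_mono (Nat.le_succ _) (Nat.le_succ _) h3
      have h2 : c₃ • s.gen₁ (k + 1) + e₃ • s.gen₂ (k + 1) ∈ s.T (k + 2) (k + 2) :=
        add_mem (Submodule.smul_mem _ _ (mem_seqSpan_left (by omega)))
          (Submodule.smul_mem _ _ (mem_seqSpan_right (by omega)))
      simpa using add_mem h1 h2
    | succ j ihj =>
      refine mem_of_smul_eq (ε_mul_sub_ne_zero hs (by omega))
        (M_mixed_s6_s7 hs (2 * k + 2) (2 * j))
        (sub_mem (Submodule.smul_mem _ _ (ihj (by omega))) (Submodule.smul_mem _ _ ?_))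
      rcases Nat.lt_or_ge (j + 1) (k + 1) with hlt | hge
      · exact s.T_mono (Nat.le_succ _) (Nat.le_succ _) (hmix (j + 1) hlt)
      · obtain rfl : j = k := by omega
        exact hP₂'

end s6_s7

end System
end Ovals

/-! ### Dimension and exact degrees in the symmetric cases -/

namespace Ovals
namespace System

open Set Polynomial

section s6_s7
variable {s : System} (hs : s = .s6 ∨ s = .s7)
include hs

lemma exists_sign_s6_s7 : ∃ ε : ℝ, s = .s6 ∧ ε = 1 ∨ s = .s7 ∧ ε = -1 := by
  rcases hs with rfl | rfl
  · exact ⟨1, Or.inl ⟨rfl, rfl⟩⟩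
  · exact ⟨-1, Or.inr ⟨rfl, rfl⟩⟩

lemma dimV_s6_s7 {n : ℕ} (hn : 1 ≤ n) : s.dimV n = (n - 1) / 2 + (n - 1) / 4 + 1 := by
  obtain ⟨ε, hs⟩ := exists_sign_s6_s7 hs
  have hlead := lead_s6_s7 hs
  choose c hc hP using fun k => (hlead k).1
  choose c₁ e₁ he₁ _ hQ using fun k => (hlead k).2.1
  have hinj := seqMap_injective_of_lead s.seqMap_gen_injective (du := 0)
    (fun k => by simpa [T] using hP k) hQ fun k => by simpa using ⟨hc k, he₁ k⟩
  rw [dimV_eq, W_s6_s7 hs hn, finrank_seqSpan hinj]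
  omega

lemma W_le_T_s6_s7 {n : ℕ} (hn : 3 ≤ n) :
    s.W n ≤ s.T ((n - 3) / 2 + 1) ((n - 3) / 2 + 1) := by
  obtain ⟨ε, hs⟩ := exists_sign_s6_s7 hs
  rw [W_s6_s7 hs (by omega)]
  refine seqSpan_le (fun k hk => ?_) fun k hk => ?_
  · obtain ⟨c, _, hP⟩ := (lead_s6_s7 hs k).1
    have h1 : c • s.gen₁ k ∈ s.T ((n - 3) / 2 + 1) ((n - 3) / 2 + 1) :=
      Submodule.smul_mem _ _ (mem_seqSpan_left (by omega))
    simpa using add_mem (s.T_mono (by omega) (by omega) hP) h1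
  · obtain ⟨c, e, _, _, hQ⟩ := (lead_s6_s7 hs k).2.1
    have h1 : c • s.gen₁ k + e • s.gen₂ k ∈ s.T ((n - 3) / 2 + 1) ((n - 3) / 2 + 1) :=
      add_mem (Submodule.smul_mem _ _ (mem_seqSpan_left (by omega)))
        (Submodule.smul_mem _ _ (mem_seqSpan_right (by omega)))
    simpa using add_mem (s.T_mono (by omega) (by omega) hQ) h1

/-- A member of `W n` whose leading coefficients with respect to both generators are nonzero. -/
lemma exists_lead_mem_W_s6_s7 {n : ℕ} (hn : 3 ≤ n) : ∃ a b : ℝ, a ≠ 0 ∧ b ≠ 0 ∧ ∃ f ∈ s.W n,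
    f - (a • s.gen₁ ((n - 3) / 2) + b • s.gen₂ ((n - 3) / 2)) ∈
      s.T ((n - 3) / 2) ((n - 3) / 2) := by
  have hd2 : s.d = 2 := by rcases hs with rfl | rfl <;> rfl
  obtain ⟨ε, hs⟩ := exists_sign_s6_s7 hs
  obtain ⟨c, e, he, hc, hQ⟩ := (lead_s6_s7 hs ((n - 3) / 2)).2.1
  -- The axis moment has both leading coefficients nonzero except at index 0, where it equals the
  -- second generator and the first must be added.
  rcases Nat.eq_zero_or_pos ((n - 3) / 2) with h0 | hpos
  · refine ⟨1, 1, one_ne_zero, one_ne_zero, s.M 0 0 + s.M 2 0,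
      add_mem (s.M_mem_W (by omega)) (s.M_mem_W (by omega)), ?_⟩
    rw [h0, gen₁_zero, gen₂_zero, hd2]
    simp
  · exact ⟨c, e, mt hc.1 hpos.ne', he, _, s.M_mem_W (by omega), hQ⟩

end s6_s7

lemma degree_neg_C_mul_X_pow_add {m : ℕ} {a : ℝ} {p : ℝ[X]} (ha : a ≠ 0)
    (hp : p ∈ degreeLT ℝ m) : (-(C a * X ^ m + p)).degree = (m : WithBot ℕ) := by
  rw [degree_neg, degree_add_eq_left_of_degree_lt, degree_C_mul_X_pow m ha]
  rw [degree_C_mul_X_pow m ha]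
  exact mem_degreeLT.1 hp

/-- A function with prescribed nonzero leading coefficients is a combination with polynomial
coefficients of exact degrees. -/
lemma exists_comb_eq {s : System} {m : ℕ} {a b : ℝ} (ha : a ≠ 0) (hb : b ≠ 0) {f : s.levels → ℝ}
    (hf : f - (a • s.gen₁ m + b • s.gen₂ m) ∈ s.T m m) :
    ∃ α β : ℝ[X], α.degree = (m : WithBot ℕ) ∧ β.degree = (m : WithBot ℕ) ∧ s.comb α β = f := by
  rw [T, seqSpan_eq_map] at hf
  obtain ⟨⟨ξ, η⟩, ⟨hξ, hη⟩, heq⟩ := hf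
  refine ⟨-(C a * X ^ m + ξ), -(C b * X ^ m + η), degree_neg_C_mul_X_pow_add ha hξ,
    degree_neg_C_mul_X_pow_add hb hη, ?_⟩
  rw [comb_eq, neg_neg, neg_neg, ← sub_add_cancel f (a • s.gen₁ m + b • s.gen₂ m), ← heq,
    ← Prod.mk_add_mk, map_add, add_comm]
  congr 1
  simp [seqMap, C_mul', constr_X_pow]

end System
end Ovals

theorem lemma1 (n : ℕ) (hn : 1 ≤ n) :
    -- `V_n` is the linear space of all combinations of the double integrals, `i + j ≤ n - 1`
    (∀ s : Ovals.System, s.V n =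
      {I | ∃ c : ℕ → ℕ → ℝ, ∀ h : s.levels,
        I h = ∑ i ∈ Finset.range n, ∑ j ∈ Finset.range (n - i), c i j * s.areaIntegral i j h}) ∧
    -- the representation, for `n ≥ 3`; equality of sets: the coefficients are arbitrary
    (3 ≤ n →
      (∀ s : Ovals.System, s = .s1 ∨ s = .s2 → s.V n = s.combs ((n - 1) / 2) ((n - 2) / 2)) ∧
      (∀ s : Ovals.System, s = .s3 → s.V n = s.combs ((n - 1) / 3) ((n - 3) / 3)) ∧
      (∀ s : Ovals.System, s = .s4 ∨ s = .s5 → s.V n = s.combs ((n - 1) / 2) ((n - 3) / 2)) ∧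
      -- in the last case there is only an inclusion, and both degrees are attained
      (∀ s : Ovals.System, s = .s6 ∨ s = .s7 →
        s.V n ⊆ s.combs ((n - 3) / 2) ((n - 3) / 2) ∧
        ∃ α β : Polynomial ℝ, α.degree = (((n - 3) / 2 : ℕ) : WithBot ℕ) ∧
          β.degree = (((n - 3) / 2 : ℕ) : WithBot ℕ) ∧
          s.comb α β ∈ s.V n)) ∧
    -- the dimensions, for `n ≥ 1`
    (∀ s : Ovals.System, s = .s1 ∨ s = .s2 → s.dimV n = n) ∧
    (∀ s : Ovals.System, s = .s3 → s.dimV n = (2 * n + 1) / 3) ∧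
    (∀ s : Ovals.System, s = .s4 ∨ s = .s5 → s.dimV n = 2 * ((n - 1) / 2) + 1) ∧
    (∀ s : Ovals.System, s = .s6 ∨ s = .s7 → s.dimV n = (n - 1) / 2 + (n - 1) / 4 + 1) := by
  refine ⟨fun s => s.V_eq_areaCombs n, fun hn3 => ⟨?_, ?_, ?_, ?_⟩, ?_, ?_, ?_, ?_⟩
  · intro s hs
    rw [Ovals.System.V_eq_W, Ovals.System.combs_eq, show (n - 1) / 2 + 1 = (n + 1) / 2 by omega,
      show (n - 2) / 2 + 1 = n / 2 by omega]
    rcases hs with rfl | rfl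
    · rw [Ovals.System.W_s1]
    · rw [Ovals.System.W_s2]
  · rintro s rfl
    rw [Ovals.System.V_eq_W, Ovals.System.combs_eq, show (n - 1) / 3 + 1 = (n + 2) / 3 by omega,
      show (n - 3) / 3 + 1 = n / 3 by omega, Ovals.System.W_s3]
  · intro s hs
    rw [Ovals.System.V_eq_W, Ovals.System.combs_eq, show (n - 1) / 2 + 1 = (n + 1) / 2 by omega,
      show (n - 3) / 2 + 1 = (n - 1) / 2 by omega]
    rcases hs with rfl | rfl
    · rw [Ovals.System.W_s4_s5 (Or.inl ⟨rfl, rfl⟩)]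
    · rw [Ovals.System.W_s4_s5 (Or.inr ⟨rfl, rfl⟩)]
  · intro s hs
    refine ⟨?_, ?_⟩
    · rw [Ovals.System.V_eq_W, Ovals.System.combs_eq]
      exact Ovals.System.W_le_T_s6_s7 hs hn3
    · obtain ⟨a, b, ha, hb, f, hf, hlead⟩ := Ovals.System.exists_lead_mem_W_s6_s7 hs hn3
      obtain ⟨α, β, hα, hβ, rfl⟩ := Ovals.System.exists_comb_eq ha hb hlead
      exact ⟨α, β, hα, hβ, by rwa [Ovals.System.V_eq_W]⟩
  · rintro s (rfl | rfl)
    · rw [Ovals.System.dimV_eq, Ovals.System.W_s1, Ovals.System.finrank_T]; omega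
    · rw [Ovals.System.dimV_eq, Ovals.System.W_s2, Ovals.System.finrank_T]; omega
  · rintro s rfl
    rw [Ovals.System.dimV_eq, Ovals.System.W_s3, Ovals.System.finrank_T]
    rcases (by omega : n % 3 = 0 ∨ n % 3 = 1 ∨ n % 3 = 2) with h | h | h <;> omega
  · rintro s (rfl | rfl)
    · rw [Ovals.System.dimV_eq, Ovals.System.W_s4_s5 (Or.inl ⟨rfl, rfl⟩),
        Ovals.System.finrank_T]; omega
    · rw [Ovals.System.dimV_eq, Ovals.System.W_s4_s5 (Or.inr ⟨rfl, rfl⟩),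
        Ovals.System.finrank_T]; omega
  · exact fun s hs => Ovals.System.dimV_s6_s7 hs hn
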